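/- **Circuits.** A quantum circuit with unbounded fan-out is $C=(V,I,O,G)$, where $V$ is a finite set of qubits, $I,O\subseteq V$ are the input and output qubits (they may overlap), and $G$ is a finite sequence of gates, each of which is $H=\frac1{\sqrt2}\begin{pmatrix}1&1\\1&-1\end{pmatrix}$, $R_z(\alpha)=\mathrm{diag}(1,e^{i\alpha})$ with $\alpha\in\mathbb R$, $\Lambda Z=\mathrm{diag}(1,1,1,-1)$, or a fan-out gate $U^{(n)}_{\mathrm{fan}}:|y_1,\dots,y_{n-1},x\rangle\mapsto|y_1\oplus x,\dots,y_{n-1}\oplus x,x\rangle$ on $n\ge 1$ qubits. It defines a quantum operation from $I$ to $O$: the non-input qubits are initialised in $|0\rangle$, the gates are applied, and the non-output qubits are measured in the standard basis and discarded. The size of $C$ is the sum over its gates of the number of qubits on which the gate acts; its depth is the length of a longest subsequence of $G$ in which any two consecutive gates act on a common qubit. **Patterns.** A measurement pattern is $t=(V,I,O,A)$ with $V$ finite, $I,O\subseteq V$, and $A$ a finite sequence of commands: $E_{i,j}$ with $i\ne j$ (apply $\Lambda Z$ to qubits $i,j$); $M_i^\alpha$ (measure qubit $i$ in the basis $|\pm_\alpha\rangle=\frac1{\sqrt2}(|0\rangle\pm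 e^{i\alpha}|1\rangle)$, with outcome $s_i\in\{0,1\}$); and the corrections $X_i^\sigma$, $Z_i^\sigma$, where $\sigma$ is a sum modulo 2 of outcomes. The non-input qubits are initialised in $|+\rangle=\frac1{\sqrt2}(|0\rangle+|1\rangle)$. The pattern is well-formed if no command acts on an already measured qubit, corrections use only outcomes already obtained, no output qubit is measured, and every non-output qubit on which some command acts is measured. It defines a quantum operation from $I$ to $O$, the sum over all measurement outcomes of the corresponding branches, restricted to the output register. The size of $t$ is the sum over its commands of the number of qubits on which the command acts (1 for $M$, $X$, $Z$ and 2 for $E$). A later command $q$ depends on an earlier command $p$ if $p$ acts on a qubit on which $q$ acts or whose outcome occurs in the exponent of $q$; the depth of $t$ is the length of a longest subsequence of $A$ in which each command depends on the one just before it in the subsequence. A pattern simulates a circuit (or a unitary) if, up to a labelling of its input and output qubits, it defines the same quantum operation. **Statement.** There is an absolute constant $c\in\mathbb N$ such that the following hold. 1. Every quantum circuit with unbounded fan-out $C$ in which each output qubit that is not an input qubit is acted on by at least one gate is simulated by a well-formed measurement pattern $t$ with $\mathrm{depth}(t)\le c\cdot\mathrm{depth}(C)$ and $\mathrm{size}(t)\le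 c\cdot\mathrm{size}(C)^3$. 2. Each of the gates $H$, $R_z(\alpha)$ ($\alpha\in\mathbb R$) and $\Lambda Z$ is simulated by a well-formed measurement pattern of size at most $c$. 3. For every $n\ge1$, let $U^{(n)}_{\mathrm{par}}:|x_1,\dots,x_n\rangle\mapsto|x_1,\dots,x_{n-1},\bigoplus_{i=1}^n x_i\rangle$. Then $U^{(n)}_{\mathrm{fan}}=H^{\otimes n}\,U^{(n)}_{\mathrm{par}}\,H^{\otimes n}$, and each of $U^{(n)}_{\mathrm{par}}$ and $U^{(n)}_{\mathrm{fan}}$ is simulated by a well-formed measurement pattern of depth at most $c$ and size at most $c\,n^3$. -/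

import Mathlib

open Finset

universe u

noncomputable section

namespace OneWay

/-! ### Registers, operators and basic gates -/

/-- Computational basis labels `|x⟩` of a register of qubits indexed by `V`. -/
abbrev Bits (V : Type*) := V → Fin 2

/-- Linear operators on the state space `(ℂ²)^{⊗ V}`, in the computational basis. -/
abbrev Op (V : Type*) := Matrix (Bits V) (Bits V) ℂ

/-- The gate `H`. -/
def hadamard : Matrix (Fin 2) (Fin 2) ℂ :=
  ((Real.sqrt 2 : ℂ)⁻¹) • !![1, 1; 1, -1]

/-- The gate `R_z(α)`. -/
def rz (α : ℝ) : Matrix (Fin 2) (Fin 2) ℂ :=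
  !![1, 0; 0, Complex.exp (Complex.I * α)]

def pauliX : Matrix (Fin 2) (Fin 2) ℂ := !![0, 1; 1, 0]

def pauliZ : Matrix (Fin 2) (Fin 2) ℂ := !![1, 0; 0, -1]

/-- The vector `|+_α⟩` (for `b = 0`) or `|-_α⟩` (for `b = 1`), that is
`(|0⟩ + (-1)^b e^{iα} |1⟩) / √2`. -/
def ketPM (α : ℝ) (b : Fin 2) : Fin 2 → ℂ :=
  ((Real.sqrt 2 : ℂ)⁻¹) • ![1, (-1) ^ (b : ℕ) * Complex.exp (Complex.I * α)]

/-- The orthogonal projector on `|±_α⟩`. -/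
def projPM (α : ℝ) (b : Fin 2) : Matrix (Fin 2) (Fin 2) ℂ :=
  Matrix.vecMulVec (ketPM α b) (star (ketPM α b))

section Operators

variable {V : Type*} [Fintype V] [DecidableEq V]

/-- The one-qubit operator `A` applied to qubit `i`, the identity on all other qubits. -/
def onQubit (A : Matrix (Fin 2) (Fin 2) ℂ) (i : V) : Op V :=
  Matrix.of fun x y => if ∀ v, v ≠ i → x v = y v then A (x i) (y i) else 0

/-- The gate `ΛZ` on qubits `i` and `j`. -/
def czOp (i j : V) : Op V :=
  Matrix.diagonal fun x => if x i = 1 ∧ x j = 1 then -1 else 1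

/-- The linear operator mapping `|y⟩` to `|f y⟩`. -/
def basisMap (f : Bits V → Bits V) : Op V :=
  Matrix.of fun x y => if x = f y then 1 else 0

/-- The fan-out gate: the bit of qubit `k` is added modulo 2 to each qubit of `T`. -/
def fanOutOp (k : V) (T : Finset V) : Op V :=
  basisMap fun y v => if v ∈ T then y v + y k else y v

/-- The parity gate: the bits of the qubits of `T` are all added modulo 2 to qubit `k`. -/
def parityOp (k : V) (T : Finset V) : Op V :=
  basisMap fun y v => if v = k then y k + ∑ j ∈ T, y j else y v

/-- `H` applied to every qubit of the register. -/
def hadamardAll (V : Type*) [Fintype V] : Op V :=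
  Matrix.of fun x y => ∏ v, hadamard (x v) (y v)

/-- Initialisation: the isometry that keeps the qubits of `I` and adds every qubit outside `I`
in the state `k`. -/
def prep (k : Fin 2 → ℂ) (I : Finset V) : Matrix (Bits V) (Bits I) ℂ :=
  Matrix.of fun x y => if (fun i : I => x i) = y then ∏ v ∈ Iᶜ, k (x v) else 0

/-- The basis label of `V` given by `x` on `O` and by `z` outside `O`. -/
def glue (O : Finset V) (x : Bits O) (z : Bits {v : V // v ∉ O}) : Bits V :=
  fun v => if h : v ∈ O then x ⟨v, h⟩ else z ⟨v, h⟩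

/-- Restriction to the register `O`: the partial trace over the other qubits. Equivalently, they
are measured in the standard basis, with outcome `z`, and the outcome is summed over. -/
def traceOut (O : Finset V) (ρ : Op V) : Op O :=
  Matrix.of fun x y => ∑ z : Bits {v : V // v ∉ O}, ρ (glue O x z) (glue O y z)

end Operators

/-- The length of a longest subsequence of `l` any two consecutive elements `p`, `q` of which
(`p` before `q`) are dependent, `dep p q`. -/
def longestChain {α : Type*} (dep : α → α → Prop) (l : List α) : ℕ :=
  sSup {n | ∃ l' : List α, l'.Sublist l ∧ l'.IsChain dep ∧ l'.length = n}

/-! ### Quantum circuits with unbounded fan-out -/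

/-- The gates: `H`, `R_z(α)`, `ΛZ` and fan-out gates of arbitrary size. -/
inductive Gate (V : Type u) : Type u
  | H (i : V)
  | Rz (α : ℝ) (i : V)
  | CZ (i j : V) (hij : i ≠ j)
  | fanOut (k : V) (T : Finset V) (hk : k ∉ T)

namespace Gate

variable {V : Type u} [Fintype V] [DecidableEq V]

/-- The qubits on which a gate acts. -/
def qubits : Gate V → Finset V
  | H i => {i}
  | Rz _ i => {i}
  | CZ i j _ => {i, j}
  | fanOut k T _ => insert k T

/-- The unitary of a gate. -/
def op : Gate V → Op V
  | H i => onQubit hadamard i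
  | Rz α i => onQubit (rz α) i
  | CZ i j _ => czOp i j
  | fanOut k T _ => fanOutOp k T

end Gate

/-- A quantum circuit with unbounded fan-out `(V, I, O, G)`. The list `G` of gates is in order of
execution. -/
structure Circuit (V : Type u) where
  I : Finset V
  O : Finset V
  G : List (Gate V)

namespace Circuit

variable {V : Type u} [Fintype V] [DecidableEq V]

/-- The unitary operator of the whole sequence of gates. -/
def unitary (C : Circuit V) : Op V :=
  C.G.foldl (fun U g => g.op * U) 1

/-- The quantum operation from the input register to the output register: the non-input qubits
are initialised in `|0⟩`, the gates are applied, the non-output qubits are measured in the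
standard basis. -/
def channel (C : Circuit V) (ρ : Op C.I) : Op C.O :=
  let J := prep ![1, 0] C.I
  traceOut C.O (C.unitary * J * ρ * (C.unitary * J).conjTranspose)

def size (C : Circuit V) : ℕ := (C.G.map fun g => #g.qubits).sum

def depth (C : Circuit V) : ℕ :=
  longestChain (fun g h => ¬ Disjoint g.qubits h.qubits) C.G

end Circuit

/-! ### Measurement patterns -/

/-- Commands: entanglement `E_{i,j}`, measurement `M_i^α`, and corrections `X_i^σ`, `Z_i^σ`, where
the finite set `σ` stands for the sum modulo 2 of the outcomes `s_j`, `j ∈ σ`. -/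
inductive Command (V : Type u) : Type u
  | E (i j : V) (hij : i ≠ j)
  | M (α : ℝ) (i : V)
  | X (i : V) (σ : Finset V)
  | Z (i : V) (σ : Finset V)

namespace Command

variable {V : Type u} [Fintype V] [DecidableEq V]

/-- The qubits on which a command acts. -/
def qubits : Command V → Finset V
  | E i j _ => {i, j}
  | M _ i => {i}
  | X i _ => {i}
  | Z i _ => {i}

/-- The qubits whose outcomes a command uses. -/
def signals : Command V → Finset V
  | E _ _ _ => ∅
  | M _ _ => ∅
  | X _ σ => σ
  | Z _ σ => σ

/-- The qubits measured by a command. -/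
def measured : Command V → Finset V
  | E _ _ _ => ∅
  | M _ i => {i}
  | X _ _ => ∅
  | Z _ _ => ∅

/-- The domain of a command: the qubits on which it acts or whose outcomes it uses. -/
def dom (p : Command V) : Finset V := p.qubits ∪ p.signals

/-- The operator of a command in the branch where the outcomes of the measurements are `s`. -/
def op (s : V → Fin 2) : Command V → Op V
  | E i j _ => czOp i j
  | M α i => onQubit (projPM α (s i)) i
  | X i σ => onQubit (pauliX ^ ((∑ j ∈ σ, s j : Fin 2) : ℕ)) i
  | Z i σ => onQubit (pauliZ ^ ((∑ j ∈ σ, s j : Fin 2) : ℕ)) i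

/-- Commands can be executed one after the other when the qubits of `m` have been measured
before: no command acts on a measured qubit, and only outcomes already known are used. -/
def Runnable (m : Finset V) : List (Command V) → Prop
  | [] => True
  | p :: l => Disjoint p.qubits m ∧ p.signals ⊆ m ∧ Runnable (m ∪ p.measured) l

/-- `q`, which comes after `p`, depends on `p`: the command `p` acts on a qubit on which `q` acts or
whose outcome `q` uses. Two corrections of distinct qubits that merely use a common (classical)
outcome are not dependent. -/
def Dependent (p q : Command V) : Prop := ¬ Disjoint p.qubits q.dom

end Command

/-- A measurement pattern `(V, I, O, A)`. The list `A` of commands is in order of execution. -/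
structure Pattern (V : Type u) where
  I : Finset V
  O : Finset V
  A : List (Command V)

namespace Pattern

variable {V : Type u} [Fintype V] [DecidableEq V]

/-- The set of all measured qubits. -/
def measured (t : Pattern V) : Finset V :=
  univ.filter fun v => ∃ p ∈ t.A, v ∈ p.measured

/-- The commands can be executed in the given order, no output qubit is measured, and every
non-output qubit on which some command acts is measured. -/
def WellFormed (t : Pattern V) : Prop :=
  Command.Runnable ∅ t.A ∧ Disjoint t.O t.measured ∧
    ∀ p ∈ t.A, ∀ v ∈ p.qubits, v ∉ t.O → v ∈ t.measured

/-- The operator of the whole sequence of commands in the branch with outcomes `s`. -/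
def branch (t : Pattern V) (s : V → Fin 2) : Op V :=
  t.A.foldl (fun U p => p.op s * U) 1

/-- The quantum operation from the input register to the output register: the non-input qubits are
initialised in `|+⟩`, the commands are applied, all possible outcomes of the measured qubits
are summed over, and only the output register is kept. -/
def channel (t : Pattern V) (ρ : Op t.I) : Op t.O :=
  let J := prep (ketPM 0 0) t.I
  ∑ s : V → Fin 2 with ∀ v, v ∉ t.measured → s v = 0,
    traceOut t.O (t.branch s * J * ρ * (t.branch s * J).conjTranspose)

/-- The pattern simulates the quantum operation `Φ` from a register `ι` to a register `κ`, for some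
identification of `ι` with the inputs of the pattern and of `κ` with its outputs. -/
def Simulates (t : Pattern V) {ι κ : Type*} (Φ : Op ι → Op κ) : Prop :=
  ∃ (eI : ι ≃ t.I) (eO : κ ≃ t.O), ∀ ρ : Op ι,
    t.channel (ρ.submatrix (fun x => x ∘ eI) (fun x => x ∘ eI)) =
      (Φ ρ).submatrix (fun y => y ∘ eO) (fun y => y ∘ eO)

/-- The pattern simulates the unitary `U` on the register `ι`. -/
def SimulatesUnitary (t : Pattern V) {ι : Type*} [Fintype ι] [DecidableEq ι] (U : Op ι) : Prop :=
  t.Simulates fun ρ => U * ρ * U.conjTranspose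

def size (t : Pattern V) : ℕ := (t.A.map fun p => #p.qubits).sum

/-- The quantum depth. -/
def depth (t : Pattern V) : ℕ := longestChain Command.Dependent t.A

end Pattern

end OneWay

end

/-!
Every gate is a product of two kinds of operations: `H R_z(-α)` on one qubit, and the product of
the gates `ΛZ` between one qubit and each of the qubits of a set. Indeed `R_z(α) = H · H R_z(α)`,
and the fan-out gate is the second operation conjugated by Hadamard gates on its targets
(`tensorOp_star_tensorOp`).

The first operation is one-qubit teleportation (`realizes_J`). The second one (`run_starLayers`)
is where constant depth comes from: the control is copied along a path of fresh qubits by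
measuring every other vertex of the path, which gives copies that are correct up to prefix sums of
the outcomes. As a correction may use the sum of any number of outcomes in a single command, all
copies are corrected at once. Each target then meets a copy of its own, and the copies are
measured in the basis `|±⟩`, which costs one final correction on the control.

In every branch such a pattern multiplies the amplitude by `1 / √2` for each measurement, applies
the unitary to the register, and leaves the other qubits in a product state (`Realizes`). Patterns
are therefore composed by composing their unitaries (`exists_compile`), and the sum over all
branches is the intended channel (`simulates_of_run`). The remaining non-output qubits may be
measured at the end, since they are traced out (`exists_wellFormed`). The pattern's `|+⟩` is
turned into `|0⟩` by Hadamard gates on the non-input qubits that are acted on; the others are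
traced out in either state (`traceOut_prep_plus`).

The depth is compared through the time `busy` at which each qubit is last acted on if everything
is executed as early as possible: layers of pairwise independent commands raise it by one
(`busy_layers`), and its maximum is at least the length of a longest chain (`longestChain_le`),
and at most that for a circuit (`busy_le_longestChain`). Depth and size grow by constant factors only (`exists_pattern`).
-/

noncomputable section

namespace OneWay

/-! ### Depth by dynamic programming -/

section Busy

variable {α W : Type*} [DecidableEq W]

/-- The time at which each qubit is last acted on when the items of `l` are executed as early as
possible, starting from the times `d`. An item `p` acts on the qubits `q p`, and has to wait for
all the qubits of its domain `dm p`. -/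
def busy (q dm : α → Finset W) (d : W → ℕ) (l : List α) : W → ℕ :=
  l.foldl (fun d p u => if u ∈ q p then (dm p).sup d + 1 else d u) d

variable {q dm : α → Finset W}

@[simp] lemma busy_nil (d : W → ℕ) : busy q dm d [] = d := rfl

lemma busy_cons (d : W → ℕ) (p : α) (l : List α) :
    busy q dm d (p :: l) =
      busy q dm (fun u => if u ∈ q p then (dm p).sup d + 1 else d u) l := rfl

lemma busy_append (d : W → ℕ) (l l' : List α) :
    busy q dm d (l ++ l') = busy q dm (busy q dm d l) l' := by
  simp [busy, List.foldl_append]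

lemma busy_of_notMem {d : W → ℕ} {l : List α} {u : W} (h : ∀ p ∈ l, u ∉ q p) :
    busy q dm d l u = d u := by
  induction l generalizing d with
  | nil => rfl
  | cons p l ih =>
    rw [busy_cons, ih fun r hr => h r (List.mem_cons_of_mem _ hr)]
    simp [h p (List.mem_cons_self ..)]

lemma le_busy (hq : ∀ p, q p ⊆ dm p) (d : W → ℕ) (l : List α) (u : W) :
    d u ≤ busy q dm d l u := by
  induction l generalizing d with
  | nil => rfl
  | cons p l ih =>
    rw [busy_cons]
    refine le_trans ?_ (ih _)
    by_cases h : u ∈ q p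
    · simpa [h] using (le_sup (f := d) (hq p h)).trans (Nat.le_succ _)
    · simp [h]

/-- Pairwise independent items all end by time `B + 1` if their domains are free at time `B`. -/
lemma busy_layer {B : ℕ} {l : List α} (hl : l.Pairwise fun p r => Disjoint (q p) (dm r))
    {d : W → ℕ} (hd : ∀ r ∈ l, ∀ u ∈ dm r, d u ≤ B) {u : W} (hu : d u ≤ B + 1) :
    busy q dm d l u ≤ B + 1 := by
  induction l generalizing d with
  | nil => exact hu
  | cons p l ih =>
    rw [busy_cons]
    rw [List.pairwise_cons] at hl
    refine ih hl.2 (fun r hr v hv => ?_) ?_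
    · rw [if_neg (Finset.disjoint_right.1 (hl.1 r hr) hv)]
      exact hd r (List.mem_cons_of_mem _ hr) v hv
    · split_ifs
      · exact Nat.succ_le_succ (Finset.sup_le (hd p (List.mem_cons_self ..)))
      · exact hu

/-- A sequence of layers of pairwise independent items takes as much time as there are layers. -/
lemma busy_layers {S : Finset W} {B : ℕ} {Ls : List (List α)}
    (hl : ∀ l ∈ Ls, l.Pairwise fun p r => Disjoint (q p) (dm r))
    (hS : ∀ l ∈ Ls, ∀ p ∈ l, dm p ⊆ S) {d : W → ℕ} (hd : ∀ u ∈ S, d u ≤ B) {u : W}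
    (hu : u ∈ S) : busy q dm d Ls.flatten u ≤ B + Ls.length := by
  induction Ls generalizing d B with
  | nil => exact hd u hu
  | cons l Ls ih =>
    rw [List.flatten_cons, busy_append, List.length_cons, Nat.add_comm _ 1, ← Nat.add_assoc]
    refine ih (fun l' h' => hl l' (List.mem_cons_of_mem _ h'))
      (fun l' h' => hS l' (List.mem_cons_of_mem _ h')) fun v hv => ?_
    exact busy_layer (hl l (List.mem_cons_self ..))
      (fun r hr w hw => hd w (hS l (List.mem_cons_self ..) r hr hw)) (Nat.le_succ_of_le (hd v hv))

lemma longestChain_bddAbove (dep : α → α → Prop) (l : List α) :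
    BddAbove {n | ∃ l' : List α, l'.Sublist l ∧ l'.IsChain dep ∧ l'.length = n} :=
  ⟨l.length, by rintro _ ⟨l', h, -, rfl⟩; exact h.length_le⟩

/-- A chain cannot start before the domain of its first item is free, and each of its items takes
one unit of time. -/
lemma chain_length_add_sup_le (hq : ∀ p, q p ⊆ dm p) (hne : ∀ p, (q p).Nonempty) {M : ℕ}
    {l : List α} {d : W → ℕ} (hM : ∀ u, busy q dm d l u ≤ M) {p : α} {l' : List α}
    (hs : (p :: l').Sublist l) (hc : (p :: l').IsChain fun p r => ¬ Disjoint (q p) (dm r)) :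
    l'.length + 1 + (dm p).sup d ≤ M := by
  induction l generalizing d p l' with
  | nil => cases hs
  | cons r l ih =>
    rw [List.cons_sublist_cons'] at hs
    have hmono : ∀ u, d u ≤ if u ∈ q r then (dm r).sup d + 1 else d u := fun u => by
      split_ifs with h
      · exact (le_sup (f := d) (hq r h)).trans (Nat.le_succ _)
      · rfl
    rcases hs with hs | ⟨rfl, hs⟩
    · refine le_trans ?_ (ih (d := fun u => if u ∈ q r then (dm r).sup d + 1 else d u) hM hs hc)
      gcongr with u
      exact hmono u
    · cases l' with
      | nil =>
        obtain ⟨u, hu⟩ := hne p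
        refine le_trans ?_ ((le_busy hq _ l u).trans (hM u))
        simp [hu, Nat.add_comm]
      | cons r' l' =>
        rw [List.isChain_cons_cons] at hc
        refine le_trans ?_ (ih (d := fun u => if u ∈ q p then (dm p).sup d + 1 else d u) hM hs hc.2)
        obtain ⟨u, hu, hu'⟩ := Finset.not_disjoint_iff.1 hc.1
        have := le_sup (f := fun u => if u ∈ q p then (dm p).sup d + 1 else d u) hu'
        simp only [hu, if_true] at this
        simp only [List.length_cons]
        omega

lemma longestChain_le (hq : ∀ p, q p ⊆ dm p) (hne : ∀ p, (q p).Nonempty) {M : ℕ}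
    {l : List α} (hM : ∀ u, busy q dm 0 l u ≤ M) :
    longestChain (fun p r => ¬ Disjoint (q p) (dm r)) l ≤ M := by
  refine csSup_le ⟨0, [], by simp⟩ ?_
  rintro _ ⟨l', hs, hc, rfl⟩
  cases l' with
  | nil => simp
  | cons p l' =>
    have := chain_length_add_sup_le hq hne hM hs hc
    simp only [List.length_cons]
    omega

/-- When items only wait for the qubits they act on, the time at which a qubit is last acted on is
the length of a chain that ends there. -/
lemma exists_chain_busy (l : List α) (u : W) :
    ∃ l' : List α, l'.Sublist l ∧ l'.IsChain (fun p r => ¬ Disjoint (q p) (q r)) ∧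
      l'.length = busy q q 0 l u ∧ ∀ r ∈ l'.getLast?, u ∈ q r := by
  induction l using List.reverseRecOn generalizing u with
  | nil => exact ⟨[], by simp⟩
  | append_singleton l p ih =>
    rw [busy_append, busy_cons, busy_nil]
    split_ifs with h
    · obtain ⟨v, hv, hv'⟩ := Finset.exists_mem_eq_sup (q p) ⟨u, h⟩ (busy q q 0 l)
      obtain ⟨l', h1, h2, h3, h4⟩ := ih v
      refine ⟨l' ++ [p], h1.append (List.Sublist.refl _), ?_, by simp [h3, hv'], by simp [h]⟩
      rw [List.isChain_append]
      refine ⟨h2, by simp, fun r hr s hs => ?_⟩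
      obtain rfl : p = s := by simpa using hs
      exact Finset.not_disjoint_iff.2 ⟨v, h4 r hr, hv⟩
    · obtain ⟨l', h1, h2⟩ := ih u
      exact ⟨l', h1.trans (List.sublist_append_left ..), h2⟩

lemma busy_le_longestChain (l : List α) (u : W) :
    busy q q 0 l u ≤ longestChain (fun p r => ¬ Disjoint (q p) (q r)) l := by
  obtain ⟨l', h1, h2, h3, -⟩ := exists_chain_busy (q := q) l u
  exact le_csSup (longestChain_bddAbove _ l) ⟨l', h1, h2, h3⟩

end Busy

/-! ### Action of one-qubit operators and commands on amplitudes -/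

/-- The sign `(-1)^{ab}`. -/
def sg (a b : Fin 2) : ℂ := if a = 1 ∧ b = 1 then -1 else 1

lemma sg_comm (a b : Fin 2) : sg a b = sg b a := by simp only [sg, and_comm]

lemma sg_mul_self (a b : Fin 2) : sg a b * sg a b = 1 := by
  unfold sg; split_ifs <;> norm_num

@[simp] lemma sg_zero_right (a : Fin 2) : sg a 0 = 1 := by simp [sg]

lemma sg_add_right (a b c : Fin 2) : sg a (b + c) = sg a b * sg a c := by
  fin_cases a <;> fin_cases b <;> fin_cases c <;> simp [sg]

lemma prod_sg {ι : Type*} (s : Finset ι) (a : Fin 2) (f : ι → Fin 2) :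
    ∏ j ∈ s, sg a (f j) = sg a (∑ j ∈ s, f j) := by
  induction s using Finset.cons_induction with
  | empty => simp
  | cons i s hi ih => rw [prod_cons, sum_cons, sg_add_right, ih]

lemma inv_sqrt_two_mul_self : ((Real.sqrt 2 : ℂ)⁻¹) * ((Real.sqrt 2 : ℂ)⁻¹) = 2⁻¹ := by
  rw [← mul_inv, ← Complex.ofReal_mul, Real.mul_self_sqrt (by norm_num)]
  norm_num

/-- A normalised one-qubit state. -/
def Normalized (k : Fin 2 → ℂ) : Prop := ∑ b, k b * star (k b) = 1

lemma normalized_ketPM (α : ℝ) (b : Fin 2) : Normalized (ketPM α b) := by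
  have h : Complex.exp (Complex.I * α) * star (Complex.exp (Complex.I * α)) = 1 := by
    rw [Complex.star_def, ← Complex.exp_conj, ← Complex.exp_add]
    simp
  have h2 := inv_sqrt_two_mul_self
  simp only [Normalized, ketPM, Fin.sum_univ_two, Pi.smul_apply, smul_eq_mul, star_mul',
    Matrix.cons_val_zero, Matrix.cons_val_one, star_pow, star_neg, star_one, mul_one, star_inv₀]
  have h3 : star (Real.sqrt 2 : ℂ) = Real.sqrt 2 := Complex.conj_ofReal _
  rw [h3]
  have h4 : ((-1 : ℂ) ^ (b : ℕ)) * (-1) ^ (b : ℕ) = 1 := by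
    rw [← mul_pow]; simp
  linear_combination (1 + (-1 : ℂ) ^ (b : ℕ) * (-1) ^ (b : ℕ)) * h2 + 2⁻¹ * h4 +
    ((Real.sqrt 2 : ℂ)⁻¹) * ((Real.sqrt 2 : ℂ)⁻¹) * ((-1 : ℂ) ^ (b : ℕ) * (-1) ^ (b : ℕ)) * h

section Action

variable {W : Type*} [Fintype W] [DecidableEq W]

/-- The function `f` does not depend on the coordinate `i`. -/
def Free (i : W) (f : Bits W → ℂ) : Prop := ∀ x b, f (Function.update x i b) = f x

omit [Fintype W] in
lemma Free.mul {i : W} {f g : Bits W → ℂ} (hf : Free i f) (hg : Free i g) :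
    Free i fun x => f x * g x := fun x b => by simp only [hf x b, hg x b]

omit [Fintype W] in
lemma Free.prod {i : W} {ι : Type*} {s : Finset ι} {f : ι → Bits W → ℂ}
    (hf : ∀ j ∈ s, Free i (f j)) : Free i fun x => ∏ j ∈ s, f j x := fun x b =>
  prod_congr rfl fun j hj => hf j hj x b

lemma onQubit_mulVec (A : Matrix (Fin 2) (Fin 2) ℂ) (i : W) (f : Bits W → ℂ) (x : Bits W) :
    (onQubit A i).mulVec f x = ∑ b, A (x i) b * f (Function.update x i b) := by
  rw [Matrix.mulVec, dotProduct]
  symm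
  refine Fintype.sum_of_injective (Function.update x i) (Function.update_injective x i) _ _ ?_ ?_
  · intro y hy
    rw [onQubit, Matrix.of_apply, if_neg, zero_mul]
    exact fun h => hy ⟨y i, by ext v; by_cases hv : v = i <;> simp_all⟩
  · intro b
    rw [onQubit, Matrix.of_apply, if_pos (fun v hv => by simp [hv])]
    simp

lemma czOp_mulVec (i j : W) (f : Bits W → ℂ) (x : Bits W) :
    (czOp i j).mulVec f x = sg (x i) (x j) * f x := by
  rw [czOp, Matrix.mulVec_diagonal, sg]

lemma onQubit_mulVec_mul {A : Matrix (Fin 2) (Fin 2) ℂ} {i : W} {g : Bits W → ℂ}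
    (hg : Free i g) (f : Bits W → ℂ) :
    (onQubit A i).mulVec (fun x => g x * f x) = fun x => g x * (onQubit A i).mulVec f x := by
  ext x
  simp only [onQubit_mulVec, hg x, mul_sum]
  exact sum_congr rfl fun b _ => by ring

lemma Free.onQubit_mulVec {A : Matrix (Fin 2) (Fin 2) ℂ} {i j : W} (hij : i ≠ j)
    {f : Bits W → ℂ} (hf : Free j f) : Free j ((onQubit A i).mulVec f) := fun x b => by
  simp only [OneWay.onQubit_mulVec, Function.update_of_ne hij]
  refine sum_congr rfl fun c _ => ?_
  rw [Function.update_comm hij.symm, hf]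

/-- The state obtained from `f` by the commands `l` in the branch with outcomes `s`. -/
def run (s : W → Fin 2) (l : List (Command W)) (f : Bits W → ℂ) : Bits W → ℂ :=
  l.foldl (fun f p => (p.op s).mulVec f) f

@[simp] lemma run_nil (s : W → Fin 2) (f : Bits W → ℂ) : run s [] f = f := rfl

lemma run_cons (s : W → Fin 2) (p : Command W) (l : List (Command W)) (f : Bits W → ℂ) :
    run s (p :: l) f = run s l ((p.op s).mulVec f) := rfl

lemma run_append (s : W → Fin 2) (l l' : List (Command W)) (f : Bits W → ℂ) :
    run s (l ++ l') f = run s l' (run s l f) := by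
  simp [run, List.foldl_append]

lemma run_smul (s : W → Fin 2) (l : List (Command W)) (c : ℂ) (f : Bits W → ℂ) :
    run s l (c • f) = c • run s l f := by
  induction l generalizing f with
  | nil => rfl
  | cons p l ih => rw [run_cons, Matrix.mulVec_smul, ih, run_cons]

lemma foldl_op_mulVec (s : W → Fin 2) (l : List (Command W)) (U : Op W) (f : Bits W → ℂ) :
    (l.foldl (fun U p => p.op s * U) U).mulVec f = run s l (U.mulVec f) := by
  induction l generalizing U with
  | nil => rfl
  | cons p l ih => rw [List.foldl_cons, ih, run_cons, Matrix.mulVec_mulVec]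

lemma run_E {n : ℕ} (s : W → Fin 2) (p q : Fin n → W) (h : ∀ j, p j ≠ q j)
    (f : Bits W → ℂ) :
    run s ((List.finRange n).map fun j => Command.E (p j) (q j) (h j)) f =
      fun x => (∏ j, sg (x (p j)) (x (q j))) * f x := by
  simp only [Fin.prod_univ_def]
  generalize List.finRange n = L
  induction L generalizing f with
  | nil => simp
  | cons j L ih =>
    rw [List.map_cons, run_cons, ih]
    ext x
    simp only [Command.op, czOp_mulVec, List.map_cons, List.prod_cons]
    ring

/-- One-qubit operations on distinct qubits act factor by factor on a product of amplitudes of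
which each factor depends on one of these qubits only. -/
lemma run_onQubit {n : ℕ} (s : W → Fin 2) (p : Fin n → Command W)
    (A : Fin n → Matrix (Fin 2) (Fin 2) ℂ) {q : Fin n → W} (hq : Function.Injective q)
    (hp : ∀ j, (p j).op s = onQubit (A j) (q j)) {B : Bits W → ℂ} {f g : Fin n → Bits W → ℂ}
    (hB : ∀ j, Free (q j) B) (hf : ∀ i j, i ≠ j → Free (q j) (f i))
    (hg : ∀ j x, (onQubit (A j) (q j)).mulVec (f j) x = g j x) :
    run s ((List.finRange n).map p) (fun x => B x * ∏ j, f j x) = fun x => B x * ∏ j, g j x := by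
  simp only [Fin.prod_univ_def]
  have hL := List.nodup_finRange n
  replace hB : ∀ j ∈ List.finRange n, Free (q j) B := fun j _ => hB j
  revert hL hB
  generalize List.finRange n = L
  intro hL hB
  induction L generalizing B with
  | nil => rfl
  | cons j L ih =>
    rw [List.nodup_cons] at hL
    have h1 : (fun x => B x * (List.map (fun i => f i x) (j :: L)).prod) =
        fun x => (B x * (L.map fun i => f i x).prod) * f j x := by
      ext x; simp only [List.map_cons, List.prod_cons]; ring
    have h2 : Free (q j) fun x => B x * (L.map fun i => f i x).prod := by
      refine (hB j (List.mem_cons_self ..)).mul fun x b => ?_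
      congr 1
      refine List.map_congr_left fun i hi => hf i j ?_ x b
      rintro rfl; exact hL.1 hi
    -- the factor of `q j`, once processed, is moved into the prefactor
    have h3 : (fun x => (B x * (L.map fun i => f i x).prod) *
        (onQubit (A j) (q j)).mulVec (f j) x) =
        fun x => (B x * g j x) * (L.map fun i => f i x).prod := by
      ext x; rw [hg]; ring
    rw [List.map_cons, run_cons, h1, hp, onQubit_mulVec_mul h2, h3, ih hL.2]
    · ext x
      simp only [List.map_cons, List.prod_cons]
      ring
    · intro i hi
      refine (hB i (List.mem_cons_of_mem _ hi)).mul fun x b => ?_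
      have hji : j ≠ i := by rintro rfl; exact hL.1 hi
      rw [← hg, ← hg]
      exact (hf j i hji).onQubit_mulVec (fun h => hji (hq h)) x b

end Action

lemma sum_pauliX_pow (c a : Fin 2) (F : Fin 2 → ℂ) :
    ∑ b, (pauliX ^ (c : ℕ)) a b * F b = F (a + c) := by
  fin_cases c <;> fin_cases a <;> simp [pauliX]

lemma sum_pauliZ_pow (c a : Fin 2) (F : Fin 2 → ℂ) :
    ∑ b, (pauliZ ^ (c : ℕ)) a b * F b = sg a c * F a := by
  fin_cases c <;> fin_cases a <;> simp [pauliZ, sg]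

lemma star_exp_I_mul (α : ℝ) : (starRingEnd ℂ) (Complex.exp (Complex.I * α)) =
    Complex.exp (-(Complex.I * α)) := by
  rw [← Complex.exp_conj]; simp

@[simp] lemma ketPM_zero_right (α : ℝ) (s : Fin 2) : ketPM α s 0 = (Real.sqrt 2 : ℂ)⁻¹ := by
  simp [ketPM]

@[simp] lemma ketPM_one_right (α : ℝ) (s : Fin 2) :
    ketPM α s 1 = (Real.sqrt 2 : ℂ)⁻¹ * ((-1) ^ (s : ℕ) * Complex.exp (Complex.I * α)) := by
  simp [ketPM]

lemma ketPM_zero_zero (b : Fin 2) : ketPM 0 0 b = (Real.sqrt 2 : ℂ)⁻¹ := by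
  fin_cases b <;> simp

lemma star_ketPM_zero (s b : Fin 2) : star (ketPM 0 s b) = (Real.sqrt 2 : ℂ)⁻¹ * sg b s := by
  fin_cases b <;> fin_cases s <;> simp [sg]

/-- One-qubit teleportation: the amplitude identity behind the pattern of `H R_z(-α)`. -/
lemma teleport_amplitude (α : ℝ) (s b c : Fin 2) :
    star (ketPM α s b) * sg b (c + s) * ketPM 0 0 (c + s) =
      (Real.sqrt 2 : ℂ)⁻¹ * (hadamard * rz (-α)) c b := by
  rw [ketPM_zero_zero]
  fin_cases s <;> fin_cases b <;> fin_cases c <;>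
    simp [sg, hadamard, rz, Matrix.mul_apply, star_exp_I_mul] <;> ring

/-- Measuring a qubit in the state `|+⟩` that controls a sign compares the other bit with the
outcome. -/
lemma sum_inv_sqrt_two_sg (c s : Fin 2) :
    ∑ b, star (ketPM 0 s b) * ((Real.sqrt 2 : ℂ)⁻¹ * sg b c) = if c = s then 1 else 0 := by
  simp only [star_ketPM_zero, Fin.sum_univ_two]
  have h := inv_sqrt_two_mul_self
  fin_cases c <;> fin_cases s <;> simp [sg] <;> linear_combination 2 * h

/-! ### Runnable sequences of commands -/

section

variable {W : Type*} [Fintype W] [DecidableEq W]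

lemma onQubit_pauliX_pow_mulVec (c : Fin 2) (i : W) (f : Bits W → ℂ) (x : Bits W) :
    (onQubit (pauliX ^ (c : ℕ)) i).mulVec f x = f (Function.update x i (x i + c)) := by
  rw [onQubit_mulVec, sum_pauliX_pow c (x i) fun b => f (Function.update x i b)]

lemma onQubit_pauliZ_pow_mulVec (c : Fin 2) (i : W) (f : Bits W → ℂ) (x : Bits W) :
    (onQubit (pauliZ ^ (c : ℕ)) i).mulVec f x = sg (x i) c * f x := by
  rw [onQubit_mulVec, sum_pauliZ_pow c (x i) fun b => f (Function.update x i b),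
    Function.update_eq_self]

lemma onQubit_projPM_mulVec (α : ℝ) (s : Fin 2) (i : W) (f : Bits W → ℂ) (x : Bits W) :
    (onQubit (projPM α s) i).mulVec f x =
      ketPM α s (x i) * ∑ b, star (ketPM α s b) * f (Function.update x i b) := by
  rw [onQubit_mulVec, mul_sum]
  exact sum_congr rfl fun b _ => by
    rw [projPM, Matrix.vecMulVec_apply, Pi.star_apply, mul_assoc]

/-- The qubits measured by a list of commands. -/
def measuredSet (l : List (Command W)) : Finset W := univ.filter fun v => ∃ p ∈ l, v ∈ p.measured

lemma mem_measuredSet {l : List (Command W)} {v : W} :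
    v ∈ measuredSet l ↔ ∃ p ∈ l, v ∈ p.measured := by
  simp [measuredSet]

lemma measuredSet_cons (p : Command W) (l : List (Command W)) :
    measuredSet (p :: l) = p.measured ∪ measuredSet l := by
  ext; simp [mem_measuredSet]

lemma measuredSet_append (l l' : List (Command W)) :
    measuredSet (l ++ l') = measuredSet l ∪ measuredSet l' := by
  ext; simp [mem_measuredSet, or_and_right, exists_or]

@[simp] lemma measuredSet_nil : measuredSet ([] : List (Command W)) = ∅ := by simp [measuredSet]

omit [Fintype W] in
lemma measured_subset_qubits (p : Command W) : p.measured ⊆ p.qubits := by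
  cases p <;> simp [Command.measured, Command.qubits]

omit [Fintype W] in
lemma qubits_subset_dom (p : Command W) : p.qubits ⊆ p.dom := subset_union_left

omit [Fintype W] in
lemma qubits_nonempty (p : Command W) : p.qubits.Nonempty := by
  cases p <;> simp [Command.qubits]

lemma runnable_append {m : Finset W} {l l' : List (Command W)} :
    Command.Runnable m (l ++ l') ↔
      Command.Runnable m l ∧ Command.Runnable (m ∪ measuredSet l) l' := by
  induction l generalizing m with
  | nil => simp [Command.Runnable]
  | cons p l ih =>
    simp only [List.cons_append, Command.Runnable, ih, measuredSet_cons, union_assoc, and_assoc]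

/-- `q` does not depend on `p` when `p` comes first. -/
abbrev Indep (p q : Command W) : Prop := Disjoint p.qubits q.dom

omit [Fintype W] in
lemma runnable_of_indep {m : Finset W} {l : List (Command W)} (hl : l.Pairwise Indep)
    (hm : ∀ p ∈ l, Disjoint p.qubits m) (hs : ∀ p ∈ l, p.signals ⊆ m) :
    Command.Runnable m l := by
  induction l generalizing m with
  | nil => trivial
  | cons p l ih =>
    rw [List.pairwise_cons] at hl
    refine ⟨hm p (List.mem_cons_self ..), hs p (List.mem_cons_self ..), ih hl.2 ?_ ?_⟩
    · intro r hr
      refine disjoint_union_right.2 ⟨hm r (List.mem_cons_of_mem _ hr), ?_⟩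
      exact ((hl.1 r hr).mono (measured_subset_qubits p) (qubits_subset_dom r)).symm
    · exact fun r hr => (hs r (List.mem_cons_of_mem _ hr)).trans subset_union_left

/-- The number of measurements in a list of commands. -/
def numMeas (l : List (Command W)) : ℕ := (l.map fun p => #p.measured).sum

omit [Fintype W] [DecidableEq W] in
lemma numMeas_append (l l' : List (Command W)) : numMeas (l ++ l') = numMeas l + numMeas l' := by
  simp [numMeas]

lemma card_measuredSet {m : Finset W} {l : List (Command W)} (h : Command.Runnable m l) :
    Disjoint m (measuredSet l) ∧ #(measuredSet l) = numMeas l := by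
  induction l generalizing m with
  | nil => simp [numMeas]
  | cons p l ih =>
    obtain ⟨h1, -, h3⟩ := h
    obtain ⟨h4, h5⟩ := ih h3
    rw [disjoint_union_left] at h4
    rw [measuredSet_cons, disjoint_union_right, card_union_of_disjoint h4.2, h5]
    exact ⟨⟨(h1.mono_left (measured_subset_qubits p)).symm, h4.1⟩, by simp [numMeas]⟩

end

/-! ### Gates realised by commands -/

/-- The gates that are compiled one by one into patterns: `H R_z(-α)` on qubit `i`, and the product
of the gates `ΛZ` between `k` and each of the qubits of `T`. -/
inductive MGate (V : Type u) : Type u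
  | J (α : ℝ) (i : V)
  | star (k : V) (T : Finset V) (hk : k ∉ T)

namespace MGate

variable {V : Type u} [Fintype V] [DecidableEq V]

/-- The qubits on which a gate acts. -/
def qubits : MGate V → Finset V
  | J _ i => {i}
  | star k T _ => insert k T

/-- The unitary of a gate. -/
def op : MGate V → Op V
  | J α i => onQubit (hadamard * rz (-α)) i
  | star k T _ => Matrix.diagonal fun x => ∏ j ∈ T, sg (x k) (x j)

end MGate

section Gadget

variable {V : Type*} [Fintype V] [DecidableEq V] {W : Type*} [Fintype W] [DecidableEq W]

/-- The product state in which the register `V`, placed on the qubits `w v`, is in the state `ψ`,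
and each other qubit `u` is in the state `χ u`. -/
def regState (w : V → W) (χ : W → Fin 2 → ℂ) (ψ : Bits V → ℂ) : Bits W → ℂ :=
  fun x => ψ (fun v => x (w v)) * ∏ u ∈ (univ.image w)ᶜ, χ u (x u)

/-- The commands `A` execute the gate `g` on the register placed at `w`, using the fresh qubits `F`
and leaving the register at `w'`. In every branch the amplitude is multiplied by `1 / √2` for each
measurement, and the qubits outside the register stay in a product state. -/
structure Realizes (g : MGate V) (w w' : V → W) (F : Finset W) (A : List (Command W)) : Prop where
  inj : Function.Injective w'
  wire_of_notMem : ∀ v ∉ g.qubits, w' v = w v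
  wire_mem : ∀ v ∈ g.qubits, w' v ∈ g.qubits.image w ∪ F
  dom_subset : ∀ p ∈ A, p.dom ⊆ g.qubits.image w ∪ F
  measured_notMem : ∀ p ∈ A, ∀ v, w' v ∉ p.measured
  runnable : ∀ m, Disjoint m (g.qubits.image w ∪ F) → Command.Runnable m A
  layers : ∃ Ls : List (List (Command W)), A = Ls.flatten ∧ Ls.length ≤ 7 ∧
    ∀ l ∈ Ls, l.Pairwise Indep
  size_le : (A.map fun p => #p.qubits).sum ≤ 9 * #g.qubits
  sem : ∀ (s : W → Fin 2) (χ : W → Fin 2 → ℂ), (∀ u ∈ F, χ u = ketPM 0 0) →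
    (∀ u, Normalized (χ u)) → ∃ χ' : W → Fin 2 → ℂ, (∀ u, Normalized (χ' u)) ∧
      (∀ u ∉ g.qubits.image w ∪ F, χ' u = χ u) ∧
      ∀ ψ : Bits V → ℂ, run s A (regState w χ ψ) =
        ((Real.sqrt 2 : ℂ)⁻¹ ^ numMeas A) • regState w' χ' (g.op.mulVec ψ)

/-- `H R_z(-α)` is realised by one-qubit teleportation to a fresh qubit. -/
lemma realizes_J (α : ℝ) (i : V) {w : V → W} (hw : Function.Injective w) {F : Finset W} {u₀ : W}
    (hu₀ : u₀ ∈ F) (hu : ∀ v, w v ≠ u₀) :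
    Realizes (MGate.J α i) w (Function.update w i u₀) F
      [Command.E (w i) u₀ (hu i), Command.M α (w i), Command.X u₀ {w i}] where
  inj := by
    intro v v' h
    by_cases h1 : v = i <;> by_cases h2 : v' = i
    · rw [h1, h2]
    · subst h1; simp [h2, (hu v').symm] at h
    · subst h2; simp [h1, hu v] at h
    · simpa [h1, h2, hw.eq_iff] using h
  wire_of_notMem v hv := by
    rw [Function.update_of_ne]; simpa [MGate.qubits] using hv
  wire_mem v hv := by
    obtain rfl : v = i := by simpa [MGate.qubits] using hv
    simp [hu₀]
  dom_subset := by
    have : w i ∈ (MGate.J α i).qubits.image w ∪ F := by simp [MGate.qubits]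
    have h2 : u₀ ∈ (MGate.J α i).qubits.image w ∪ F := by simp [hu₀]
    simp [Command.dom, Command.qubits, Command.signals, insert_subset_iff, this, h2,
      -mem_union, -union_insert]
  measured_notMem := by
    have : ∀ v, Function.update w i u₀ v ≠ w i := fun v => by
      by_cases h : v = i
      · subst h; simpa using (hu v).symm
      · simp [h, hw.eq_iff]
    simp [Command.measured, this]
  runnable m hm := by
    have h1 : w i ∉ m := fun h => disjoint_left.1 hm h (by simp [MGate.qubits])
    have h2 : u₀ ∉ m := fun h => disjoint_left.1 hm h (by simp [hu₀])
    simp [Command.Runnable, Command.qubits, Command.signals, Command.measured, h1, h2,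
      (hu i).symm]
  layers := ⟨[[Command.E (w i) u₀ (hu i)], [Command.M α (w i)], [Command.X u₀ {w i}]],
    by simp, by simp, by simp⟩
  size_le := by
    have := card_le_two (a := w i) (b := u₀)
    simp [Command.qubits, MGate.qubits]; omega
  sem s χ hF hN := by
    refine ⟨Function.update χ (w i) (ketPM α (s (w i))), fun u => ?_, fun u hu' => ?_,
      fun ψ => ?_⟩
    · by_cases h : u = w i
      · subst h; simpa using normalized_ketPM _ _
      · simpa [h] using hN u
    · rw [Function.update_of_ne]
      rintro rfl; exact hu' (by simp [MGate.qubits])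
    · have hR : u₀ ∈ (univ.image w)ᶜ := by simpa using hu
      have hR' : (univ.image (Function.update w i u₀))ᶜ =
          insert (w i) ((univ.image w)ᶜ.erase u₀) := by
        ext u
        simp only [mem_compl, mem_image, mem_univ, true_and, mem_insert, mem_erase, not_exists]
        constructor
        · intro h
          by_cases h1 : u = w i
          · exact Or.inl h1
          · refine Or.inr ⟨fun h2 => h i (by simp [h2]), fun v hv => ?_⟩
            by_cases h3 : v = i
            · exact h1 (by rw [← hv, h3])
            · exact h v (by simpa [h3] using hv)
        · rintro (rfl | ⟨h1, h2⟩) v hv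
          · by_cases h3 : v = i
            · subst h3; exact hu v (by simpa using hv.symm)
            · simp [h3, hw.eq_iff] at hv
          · by_cases h3 : v = i
            · subst h3; exact h1 (by simpa using hv.symm)
            · exact h2 v (by simpa [h3] using hv)
      have hwi : w i ∉ (univ.image w)ᶜ.erase u₀ := by simp
      ext x
      simp only [run_cons, run_nil, Command.op, sum_singleton, onQubit_pauliX_pow_mulVec,
        onQubit_projPM_mulVec, czOp_mulVec, regState, numMeas, Command.measured, MGate.op,
        List.map_cons, List.map_nil, List.sum_cons, List.sum_nil, card_empty, card_singleton,
        Pi.smul_apply, smul_eq_mul, hR', prod_insert hwi]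
      rw [onQubit_mulVec]
      have h1 : ∀ b, (fun v => Function.update (Function.update x u₀ (x u₀ + s (w i))) (w i) b
          (w v)) = Function.update (fun v => x (Function.update w i u₀ v)) i b := by
        intro b; ext v
        by_cases h : v = i
        · subst h; simp
        · simp [h, hw.eq_iff, hu v]
      have h2 : ∀ b, ∏ u ∈ (univ.image w)ᶜ, χ u (Function.update
          (Function.update x u₀ (x u₀ + s (w i))) (w i) b u) =
          ketPM 0 0 (x u₀ + s (w i)) * ∏ u ∈ (univ.image w)ᶜ.erase u₀, χ u (x u) := by
        intro b
        rw [← mul_prod_erase _ _ hR, hF u₀ hu₀, Function.update_of_ne (hu i).symm,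
          Function.update_self]
        congr 1
        refine prod_congr rfl fun u hu' => ?_
        simp only [mem_erase, mem_compl, mem_image, mem_univ, true_and, not_exists] at hu'
        rw [Function.update_of_ne fun h => hu'.2 i h.symm, Function.update_of_ne hu'.1]
      have h3 : ∏ u ∈ (univ.image w)ᶜ.erase u₀,
          Function.update χ (w i) (ketPM α (s (w i))) u (x u) =
          ∏ u ∈ (univ.image w)ᶜ.erase u₀, χ u (x u) :=
        prod_congr rfl fun u hu' => by
          rw [Function.update_of_ne]; rintro rfl; exact hwi hu'
      simp only [h1, h2, h3, Function.update_self, Function.update_of_ne (hu i).symm,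
        Function.update_of_ne (hu i)]
      rw [mul_sum, sum_mul, mul_sum]
      refine sum_congr rfl fun b _ => ?_
      have := teleport_amplitude α (s (w i)) b (x u₀)
      linear_combination (ketPM α (s (w i)) (x (w i)) * ψ (Function.update (fun v => x
        (Function.update w i u₀ v)) i b) * ∏ u ∈ (univ.image w)ᶜ.erase u₀, χ u (x u)) * this

end Gadget

/-! ### Products of `ΛZ` gates with a common control -/

/-- Bits with prescribed sums of neighbours are prefix sums. -/
lemma forall_add_succ_iff {n : ℕ} (X : Fin (n + 1) → Fin 2) (t : Fin n → Fin 2) :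
    (∀ j : Fin n, X j.castSucc + X j.succ = t j) ↔
      ∀ j : Fin n, X j.succ = X 0 + ∑ i ∈ Iic j, t i := by
  have h2 : ∀ a b c : Fin 2, a + b = c ↔ b = a + c := by decide
  set P : Fin (n + 1) → Fin 2 := fun i => ∑ j ∈ univ.filter (fun j : Fin n => j.castSucc < i), t j
    with hP
  have hP0 : P 0 = 0 := by simp [hP]
  have hPs : ∀ j : Fin n, P j.succ = ∑ i ∈ Iic j, t i := fun j => by
    refine sum_congr ?_ fun _ _ => rfl
    ext i
    simp
  have hPc : ∀ j : Fin n, P j.succ = P j.castSucc + t j := fun j => by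
    have : (univ.filter fun i : Fin n => i.castSucc < j.succ) =
        insert j (univ.filter fun i : Fin n => i.castSucc < j.castSucc) := by
      ext i
      simp [le_iff_eq_or_lt]
    simp only [hP, this]
    rw [sum_insert (by simp), add_comm]
  simp only [h2, ← hPs]
  constructor
  · intro h
    have : ∀ i, X i = X 0 + P i := fun i => by
      induction i using Fin.induction with
      | zero => simp [hP0]
      | succ i ih => rw [h, ih, hPc, add_assoc]
    exact fun j => this _
  · intro h
    have : ∀ i, X i = X 0 + P i := fun i => by
      cases i using Fin.cases with
      | zero => simp [hP0]
      | succ i => exact h i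
    exact fun j => by rw [this, hPc, this j.castSucc, add_assoc]

section Star

variable {V : Type*} [Fintype V] [DecidableEq V] {W : Type*} [Fintype W] [DecidableEq W]

omit [Fintype V] [DecidableEq V] [Fintype W] in
lemma free_comp {w : V → W} {u : W} (hu : ∀ v, w v ≠ u) (ψ : Bits V → ℂ) :
    Free u fun x => ψ fun v => x (w v) := fun x b => by
  simp [hu]

omit [Fintype W] in
lemma free_coord {u v : W} (huv : v ≠ u) (k : Fin 2 → ℂ) : Free u fun x => k (x v) :=
  fun x b => by simp [huv]

omit [Fintype W] in
lemma pairwise_indep_finRange {n : ℕ} {p : Fin n → Command W}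
    (h : ∀ i j, i ≠ j → Indep (p i) (p j)) : ((List.finRange n).map p).Pairwise Indep := by
  rw [List.pairwise_map]
  exact (List.nodup_finRange n).imp fun hij => h _ _ hij

/-- The layers of commands that apply `ΛZ` between `k` and every `y j` in constant depth. The qubits
`k, c 0, c 1, …`, linked through the qubits `a j`, form a path. The measurements of the `a j` and
corrections by prefix sums of their outcomes turn every `c j` into a copy of the bit of `k`, which
is entangled with one target and then measured. -/
def starLayers {n : ℕ} {k : W} {y a c : Fin n → W}
    (hca : ∀ i j, (Fin.cons k c : Fin (n + 1) → W) i ≠ a j)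
    (hac : ∀ j, a j ≠ c j) (hcy : ∀ j, c j ≠ y j) :
    List (List (Command W)) :=
  [(List.finRange n).map fun j =>
      Command.E ((Fin.cons k c : Fin (n + 1) → W) j.castSucc) (a j) (hca _ _),
    (List.finRange n).map fun j => Command.E (a j) (c j) (hac j),
    (List.finRange n).map fun j => Command.M 0 (a j),
    (List.finRange n).map fun j => Command.X (c j) ((Iic j).image a),
    (List.finRange n).map fun j => Command.E (c j) (y j) (hcy j),
    (List.finRange n).map fun j => Command.M 0 (c j),
    [Command.Z k (univ.image c)]]

/-- The effect of `starLayers` in a branch: every target `y j` picks up the sign `(-1)^{x_k x_{y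
j}}`, the auxiliary qubits end in product states, and the `2 n` measurements contribute `2^{-n}`.
-/
lemma run_starLayers {n : ℕ} {k : W} {y a c : Fin n → W}
    (hca : ∀ i j, (Fin.cons k c : Fin (n + 1) → W) i ≠ a j)
    (hac : ∀ j, a j ≠ c j) (hcy : ∀ i j, c i ≠ y j) (ha : Function.Injective a)
    (hcc : Function.Injective (Fin.cons k c : Fin (n + 1) → W)) {Φ : Bits W → ℂ}
    (hΦa : ∀ j, Free (a j) Φ) (hΦc : ∀ j, Free (c j) Φ) (s : W → Fin 2) :
    run s (starLayers hca hac fun j => hcy j j).flatten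
        (fun x => Φ x * ((∏ j, ketPM 0 0 (x (a j))) * ∏ j, ketPM 0 0 (x (c j)))) =
      fun x => ((Real.sqrt 2 : ℂ)⁻¹ ^ (2 * n)) * ((∏ j, sg (x k) (x (y j))) * Φ x) *
        ((∏ j, ketPM 0 (s (a j)) (x (a j))) * ∏ j, ketPM 0 (s (c j)) (x (c j))) := by
  have hc : Function.Injective c := (Fin.cons_injective_iff.1 hcc).2
  have hkc : ∀ j, k ≠ c j := fun j h => (Fin.cons_injective_iff.1 hcc).1 ⟨j, h.symm⟩
  have hca' : ∀ i j, c i ≠ a j := fun i => hca i.succ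
  set r : ℂ := (Real.sqrt 2 : ℂ)⁻¹ with hr
  simp only [starLayers, List.flatten_cons, List.flatten_nil, List.append_nil, run_append, run_E]
  -- the path, with the factor of each `a j` singled out
  have h1 : (fun x : Bits W => (∏ j, sg (x (a j)) (x (c j))) *
      ((∏ j : Fin n, sg (x ((Fin.cons k c : Fin (n + 1) → W) j.castSucc)) (x (a j))) *
        (Φ x * ((∏ j, ketPM 0 0 (x (a j))) * ∏ j, ketPM 0 0 (x (c j)))))) =
      fun x => (Φ x * r ^ n) * ∏ j : Fin n, r * sg (x (a j))
        (x ((Fin.cons k c : Fin (n + 1) → W) j.castSucc) + x (c j)) := by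
    ext x
    simp only [ketPM_zero_zero, sg_add_right, prod_mul_distrib, prod_const, card_univ,
      Fintype.card_fin, ← hr]
    simp only [sg_comm (x (a _)) (x ((Fin.cons k c : Fin (n + 1) → W) _))]
    ring
  rw [h1, run_onQubit s _ (fun j => projPM 0 (s (a j))) ha (fun j => rfl)
    (g := fun j x => ketPM 0 (s (a j)) (x (a j)) *
      if x ((Fin.cons k c : Fin (n + 1) → W) j.castSucc) + x (c j) = s (a j) then 1 else 0)]
  rotate_left
  · exact fun j => (hΦa j).mul fun _ _ => rfl
  · intro i j hij x b
    simp [hca _ _, hca' _ _, ha.ne hij]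
  · intro j x
    simp only [onQubit_projPM_mulVec, Function.update_self, Function.update_of_ne (hca _ _),
      Function.update_of_ne (hca' _ _)]
    rw [← sum_inv_sqrt_two_sg]
  -- all the `c j` are copies of `k`, up to the prefix sums of the outcomes
  have h2 : (fun x : Bits W => Φ x * r ^ n * ∏ j : Fin n, ketPM 0 (s (a j)) (x (a j)) *
      if x ((Fin.cons k c : Fin (n + 1) → W) j.castSucc) + x (c j) = s (a j) then 1 else 0) =
      fun x => (Φ x * ∏ j, ketPM 0 (s (a j)) (x (a j))) * ∏ j : Fin n, r *
        if x (c j) = x k + ∑ i ∈ Iic j, s (a i) then 1 else 0 := by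
    ext x
    have := forall_add_succ_iff (fun i => x ((Fin.cons k c : Fin (n + 1) → W) i))
      fun j => s (a j)
    simp only [Fin.cons_succ, Fin.cons_zero] at this
    simp only [prod_mul_distrib, prod_boole, mem_univ, true_implies, this, prod_const, card_univ,
      Fintype.card_fin]
    ring
  have hsum : ∀ j, ∑ u ∈ (Iic j).image a, s u = ∑ i ∈ Iic j, s (a i) := fun j =>
    sum_image ha.injOn
  have hfree : ∀ j, Free (c j) fun x => Φ x * ∏ j, ketPM 0 (s (a j)) (x (a j)) := fun j =>
    (hΦc j).mul (Free.prod fun i _ => free_coord (hca' j i).symm _)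
  rw [h2, run_onQubit s _ (fun j => pauliX ^ ((∑ i ∈ Iic j, s (a i) : Fin 2) : ℕ)) hc
    (fun j => by rw [Command.op, hsum]) (g := fun j x => r * if x (c j) = x k then 1 else 0)]
  rotate_left
  · exact hfree
  · intro i j hij x b
    simp [hkc, hc.ne hij]
  · intro j x
    simp only [onQubit_pauliX_pow_mulVec, Function.update_self, Function.update_of_ne (hkc _),
      add_left_inj]
  -- each target meets its own copy
  have h3 : (fun x : Bits W => (∏ j, sg (x (c j)) (x (y j))) *
      (Φ x * (∏ j, ketPM 0 (s (a j)) (x (a j))) *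
        ∏ j : Fin n, r * if x (c j) = x k then 1 else 0)) =
      fun x => (Φ x * ∏ j, ketPM 0 (s (a j)) (x (a j))) *
        ∏ j : Fin n, sg (x (c j)) (x (y j)) * (r * if x (c j) = x k then 1 else 0) := by
    ext x
    simp only [prod_mul_distrib]
    ring
  rw [h3, run_onQubit s _ (fun j => projPM 0 (s (c j))) hc (fun j => rfl)
    (g := fun j x => ketPM 0 (s (c j)) (x (c j)) *
      (r * r * sg (x k) (x (y j)) * sg (x k) (s (c j))))]
  rotate_left
  · exact hfree
  · intro i j hij x b
    simp [hkc, hc.ne hij, (hcy _ _).symm]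
  · intro j x
    simp only [onQubit_projPM_mulVec, Function.update_self, Function.update_of_ne (hkc _),
      Function.update_of_ne (hcy _ _).symm]
    congr 1
    simp only [star_ketPM_zero, mul_ite, mul_one, mul_zero, sum_ite_eq', mem_univ, if_true]
    ring
  ext x
  rw [run_cons, run_nil, Command.op, onQubit_pauliZ_pow_mulVec, sum_image hc.injOn]
  simp only [prod_mul_distrib, prod_const, card_univ, Fintype.card_fin,
    prod_sg univ (x k) fun j => s (c j)]
  linear_combination (Φ x * (∏ j, ketPM 0 (s (a j)) (x (a j))) *
    (∏ j, ketPM 0 (s (c j)) (x (c j))) * (r ^ n * r ^ n * ∏ j, sg (x k) (x (y j)))) *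
    sg_mul_self (x k) (∑ j, s (c j))

end Star

section Star

variable {V : Type u} [Fintype V] [DecidableEq V] {W : Type*} [Fintype W] [DecidableEq W]

/-- A product of `ΛZ` gates with a common control is realised in constant depth on fresh qubits. -/
lemma exists_realizes_star (k : V) (T : Finset V) (hk : k ∉ T) {w : V → W}
    (hw : Function.Injective w) {F : Finset W} (hwF : ∀ v, w v ∉ F) {n : ℕ} (e : Fin n ≃ T)
    {a c : Fin n → W} (ha : Function.Injective a)
    (hc : Function.Injective c) (hac : ∀ i j, c i ≠ a j) (haF : ∀ i, a i ∈ F)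
    (hcF : ∀ i, c i ∈ F) : ∃ A, Realizes (MGate.star k T hk) w w F A := by
  have hn : #T = n := by simpa using (Fintype.card_congr e).symm
  have hwa : ∀ v i, w v ≠ a i := fun v i h => hwF v (h ▸ haF i)
  have hwc : ∀ v i, w v ≠ c i := fun v i h => hwF v (h ▸ hcF i)
  have hca : ∀ i j, (Fin.cons (w k) c : Fin (n + 1) → W) i ≠ a j := fun i j => by
    cases i using Fin.cases with
    | zero => exact hwa k j
    | succ i => exact hac i j
  have hcc : Function.Injective (Fin.cons (w k) c : Fin (n + 1) → W) :=
    Fin.cons_injective_iff.2 ⟨by rintro ⟨i, hi⟩; exact hwc k i hi.symm, hc⟩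
  have hcy : ∀ i j, c i ≠ w (e j) := fun i j => (hwc _ _).symm
  have hey : ∀ i j, w (e i) = w (e j) ↔ i = j := fun i j => by
    rw [hw.eq_iff, Subtype.val_inj, e.injective.eq_iff]
  have hLs : ∀ l ∈ starLayers hca (fun j => (hac j j).symm) fun j => hcy j j,
      l.Pairwise Indep := by
    simp only [starLayers, List.forall_mem_cons]
    refine ⟨?_, ?_, ?_, ?_, ?_, ?_, by simp, by simp⟩ <;>
      refine pairwise_indep_finRange fun i j hij => ?_
    · simp [Indep, Command.qubits, Command.dom, Command.signals, hcc.eq_iff, hca, hij.symm,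
        ha.eq_iff, (hca _ _).symm]
    · simp [Indep, Command.qubits, Command.dom, Command.signals, hc.eq_iff, hac, hij.symm,
        ha.eq_iff, (hac _ _).symm]
    · simp [Indep, Command.qubits, Command.dom, Command.signals, hij, ha.eq_iff]
    · simp [Indep, Command.qubits, Command.dom, Command.signals, hij, hc.eq_iff, (hac _ _).symm]
    · simp [Indep, Command.qubits, Command.dom, Command.signals, hij.symm, hc.eq_iff, hcy, hey,
        (hcy _ _).symm]
    · simp [Indep, Command.qubits, Command.dom, Command.signals, hij, hc.eq_iff]
  set S := (MGate.star k T hk).qubits.image w ∪ F with hS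
  have hkS : w k ∈ S := by simp [hS, MGate.qubits]
  have hyS : ∀ j, w (e j) ∈ S := fun j =>
    mem_union_left _ (mem_image_of_mem _ (by simp [MGate.qubits]))
  have haS : ∀ j, a j ∈ S := fun j => mem_union_right _ (haF j)
  have hcS : ∀ j, c j ∈ S := fun j => mem_union_right _ (hcF j)
  have hccS : ∀ j, (Fin.cons (w k) c : Fin (n + 1) → W) j ∈ S := fun j => by
    cases j using Fin.cases with
    | zero => exact hkS
    | succ j => exact hcS j
  refine ⟨(starLayers hca (fun j => (hac j j).symm) fun j => hcy j j).flatten, hw,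
    fun _ _ => rfl, fun v hv => ?_, ?_, ?_, fun m hm => ?_, ⟨_, rfl, by simp [starLayers], hLs⟩,
    ?_, fun s χ hF hN => ?_⟩
  · exact mem_union_left _ (mem_image_of_mem _ hv)
  · change ∀ p ∈ (_ : List (Command W)), p.dom ⊆ S
    clear_value S
    simp [starLayers, or_imp, forall_and, Command.dom, Command.qubits, Command.signals, hccS,
      insert_subset_iff, haS, hcS, hyS, hkS, image_subset_iff]
  · simp [starLayers, or_imp, forall_and, Command.measured, hwa, hwc]
  · have hm' : ∀ u ∈ S, u ∉ m := fun u hu h => disjoint_left.1 hm h hu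
    simp only [starLayers, List.forall_mem_cons] at hLs
    obtain ⟨l1, l2, l3, l4, l5, l6, l7, -⟩ := hLs
    simp only [starLayers, List.flatten_cons, List.flatten_nil, List.append_nil,
      runnable_append]
    have e1 : measuredSet ((List.finRange n).map fun j => Command.E
        ((Fin.cons (w k) c : Fin (n + 1) → W) j.castSucc) (a j) (hca _ _)) = ∅ := by
      ext; simp [mem_measuredSet, Command.measured]
    have e2 : measuredSet ((List.finRange n).map fun j => Command.E (a j) (c j)
        (hac j j).symm) = ∅ := by
      ext; simp [mem_measuredSet, Command.measured]
    have e3 : measuredSet ((List.finRange n).map fun j => Command.M 0 (a j)) = univ.image a := by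
      ext; simp [mem_measuredSet, Command.measured, eq_comm]
    have e4 : measuredSet ((List.finRange n).map fun j => Command.X (c j) ((Iic j).image a)) =
        ∅ := by
      ext; simp [mem_measuredSet, Command.measured]
    have e5 : measuredSet ((List.finRange n).map fun j => Command.E (c j) (w (e j)) (hcy j j)) =
        ∅ := by
      ext; simp [mem_measuredSet, Command.measured]
    have e6 : measuredSet ((List.finRange n).map fun j => Command.M 0 (c j)) = univ.image c := by
      ext; simp [mem_measuredSet, Command.measured, eq_comm]
    simp only [e1, e2, e3, e4, e5, e6, union_empty]
    refine ⟨runnable_of_indep l1 ?_ ?_, runnable_of_indep l2 ?_ ?_, runnable_of_indep l3 ?_ ?_,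
      runnable_of_indep l4 ?_ ?_, runnable_of_indep l5 ?_ ?_, runnable_of_indep l6 ?_ ?_,
      runnable_of_indep l7 ?_ ?_⟩ <;>
      simp [Command.qubits, Command.signals, hm' _ (hccS _), hm' _ (haS _), hm' _ (hcS _),
        hm' _ (hyS _), hm' _ hkS, (hac _ _).symm, (hwa _ _).symm, (hwc _ _).symm,
        image_subset_iff]
  · have h2 : ∀ x y : W, #{x, y} ≤ 2 := fun x y => card_le_two
    simp only [starLayers, List.flatten_cons, List.flatten_nil, List.append_nil, List.map_append,
      List.map_map, List.sum_append, List.map_cons, List.map_nil, List.sum_cons, List.sum_nil,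
      Function.comp_def, Command.qubits, card_singleton, ← Fin.sum_univ_def, sum_const, card_univ,
      Fintype.card_fin, smul_eq_mul, MGate.qubits, card_insert_of_notMem hk, hn]
    have h1 := sum_le_card_nsmul univ
      (fun j : Fin n => #{(Fin.cons (w k) c : Fin (n + 1) → W) j.castSucc, a j}) 2
      fun j _ => h2 _ _
    have h3 := sum_le_card_nsmul univ (fun j : Fin n => #{a j, c j}) 2 fun j _ => h2 _ _
    have h4 := sum_le_card_nsmul univ (fun j : Fin n => #{c j, w (e j)}) 2 fun j _ => h2 _ _
    simp only [card_univ, Fintype.card_fin, smul_eq_mul] at h1 h3 h4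
    omega
  · let χ' : W → Fin 2 → ℂ := fun u =>
      if u ∈ univ.image a ∪ univ.image c then ketPM 0 (s u) else χ u
    refine ⟨χ', fun u => ?_, fun u hu => ?_, fun ψ => ?_⟩
    · simp only [χ']; split_ifs
      · exact normalized_ketPM _ _
      · exact hN u
    · refine if_neg fun h => hu ?_
      simp only [mem_union, mem_image, mem_univ, true_and] at h
      rcases h with ⟨j, rfl⟩ | ⟨j, rfl⟩
      · exact haS j
      · exact hcS j
    · have hsub : univ.image a ∪ univ.image c ⊆ (univ.image w)ᶜ := by
        intro u hu
        simp only [mem_union, mem_image, mem_univ, true_and] at hu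
        rcases hu with ⟨j, rfl⟩ | ⟨j, rfl⟩ <;> simp [hwa, hwc]
      have hdis : Disjoint (univ.image a) (univ.image c) := by
        simp [disjoint_left, hac]
      set R := (univ.image w)ᶜ \ (univ.image a ∪ univ.image c) with hR
      have hprod : ∀ (κ : W → Fin 2 → ℂ) (x : Bits W), ∏ u ∈ (univ.image w)ᶜ, κ u (x u) =
          (∏ u ∈ R, κ u (x u)) * ((∏ j, κ (a j) (x (a j))) * ∏ j, κ (c j) (x (c j))) := by
        intro κ x
        rw [← prod_sdiff hsub, prod_union hdis, prod_image ha.injOn, prod_image hc.injOn]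
      have h1 : regState w χ ψ = fun x => (ψ (fun v => x (w v)) * ∏ u ∈ R, χ u (x u)) *
          ((∏ j, ketPM 0 0 (x (a j))) * ∏ j, ketPM 0 0 (x (c j))) := by
        ext x
        simp only [regState, hprod, hF _ (haF _), hF _ (hcF _), mul_assoc]
      rw [h1, run_starLayers hca _ hcy ha hcc]
      rotate_left
      · refine fun j => (free_comp (fun v => hwa v j) ψ).mul (Free.prod fun u hu =>
          free_coord ?_ _)
        rintro rfl; simp [hR] at hu
      · refine fun j => (free_comp (fun v => hwc v j) ψ).mul (Free.prod fun u hu =>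
          free_coord ?_ _)
        rintro rfl; simp [hR] at hu
      have hnum : numMeas (starLayers hca (fun j => (hac j j).symm) fun j => hcy j j).flatten =
          2 * n := by
        simp [starLayers, numMeas, Function.comp_def, Command.measured, two_mul]
      ext x
      have hχa : ∀ j, χ' (a j) = ketPM 0 (s (a j)) := fun j => if_pos (by simp)
      have hχc : ∀ j, χ' (c j) = ketPM 0 (s (c j)) := fun j => if_pos (by simp)
      have hχR : ∏ u ∈ R, χ' u (x u) = ∏ u ∈ R, χ u (x u) := prod_congr rfl fun u hu => by
        simp only [χ']
        rw [if_neg (mem_sdiff.1 hu).2]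
      have hT : ∏ j, sg (x (w k)) (x (w (e j))) = ∏ v ∈ T, sg (x (w k)) (x (w v)) := by
        rw [← prod_coe_sort T fun v => sg (x (w k)) (x (w v))]
        exact Fintype.prod_equiv e _ _ fun _ => rfl
      simp only [Pi.smul_apply, smul_eq_mul, regState, hprod, hχa, hχc, hχR, MGate.op,
        Matrix.mulVec_diagonal, hnum, hT]
      ring

/-- Every gate is realised on any placement of its register, given two fresh qubits for each
qubit of the register. -/
lemma exists_realizes (g : MGate V) {w : V → W} (hw : Function.Injective w)
    {fr : V × Bool → W} (hfr : Function.Injective fr) (hwfr : ∀ v p, w v ≠ fr p) :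
    ∃ w' A, Realizes g w w' (univ.image fr) A := by
  cases g with
  | J α i => exact ⟨_, _, realizes_J α i hw (u₀ := fr (i, false)) (by simp) fun v => hwfr v _⟩
  | star k T hk =>
    refine ⟨w, exists_realizes_star k T hk hw (by simpa [eq_comm] using hwfr) T.equivFin.symm
      (a := fun j => fr (T.equivFin.symm j, false)) (c := fun j => fr (T.equivFin.symm j, true))
      ?_ ?_ ?_ ?_ ?_⟩
    · intro i j h
      simpa [hfr.eq_iff] using h
    · intro i j h
      simpa [hfr.eq_iff] using h
    · simp [hfr.eq_iff]
    · simp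
    · simp

end Star

/-! ### Patterns of sequences of gates -/

section Compile

variable {V : Type u} [Fintype V] [DecidableEq V]

/-- The unitary of a sequence of gates. -/
def MGate.unitary (G : List (MGate V)) : Op V := G.foldl (fun U g => g.op * U) 1

lemma foldl_mul_eq {α : Type*} (f : α → Op V) (G : List α) (U : Op V) :
    G.foldl (fun U g => f g * U) U = G.foldl (fun U g => f g * U) 1 * U := by
  induction G generalizing U with
  | nil => simp
  | cons g G ih =>
    rw [List.foldl_cons, ih, List.foldl_cons, ih (f g * 1), mul_one, Matrix.mul_assoc]

lemma MGate.unitary_cons (g : MGate V) (G : List (MGate V)) :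
    MGate.unitary (g :: G) = MGate.unitary G * g.op := by
  rw [unitary, List.foldl_cons, foldl_mul_eq, mul_one, unitary]

lemma MGate.unitary_append (G G' : List (MGate V)) :
    MGate.unitary (G ++ G') = MGate.unitary G' * MGate.unitary G := by
  rw [unitary, List.foldl_append, foldl_mul_eq, unitary, unitary]

/-- A sequence of gates with distinct labels is realised gate by gate, the qubits that carry the
label of a gate being reserved for it. The clause on `busy` says that the commands take at most
seven times as long as the gates; the last clause is that of `Realizes`. -/
lemma exists_compile {Λ : Type*} [Fintype Λ] [DecidableEq Λ] (G : List (Λ × MGate V))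
    (hG : (G.map Prod.fst).Nodup) {w : V → V × Option Λ × Bool} (hw : Function.Injective w)
    (hwG : ∀ v, ∀ a ∈ G.map Prod.fst, (w v).2.1 ≠ some a) :
    ∃ (w' : V → V × Option Λ × Bool) (A : List (Command (V × Option Λ × Bool))),
      Function.Injective w' ∧
      (∀ v, w' v ∈ Set.range w ∨ ∃ a ∈ G.map Prod.fst, (w' v).2.1 = some a) ∧
      (∀ m : Finset (V × Option Λ × Bool), (∀ v, w v ∉ m) →
        (∀ u ∈ m, ∀ a ∈ G.map Prod.fst, u.2.1 ≠ some a) → Command.Runnable m A) ∧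
      (∀ v, w' v ∉ measuredSet A) ∧
      (A.map fun p => #p.qubits).sum ≤ 9 * (G.map fun g => #g.2.qubits).sum ∧
      (∀ (d : V × Option Λ × Bool → ℕ) (e : V → ℕ) (M : ℕ), (∀ v, d (w v) ≤ 7 * e v) →
        (∀ u, ∀ a ∈ G.map Prod.fst, u.2.1 = some a → d u = 0) → (∀ u, d u ≤ 7 * M) →
        (∀ v, busy MGate.qubits MGate.qubits e (G.map Prod.snd) v ≤ M) →
        ∀ u, busy Command.qubits Command.dom d A u ≤ 7 * M) ∧
      (∀ (s : V × Option Λ × Bool → Fin 2) (χ : V × Option Λ × Bool → Fin 2 → ℂ),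
        (∀ u, ∀ a ∈ G.map Prod.fst, u.2.1 = some a → χ u = ketPM 0 0) → (∀ u, Normalized (χ u)) →
        ∃ χ' : V × Option Λ × Bool → Fin 2 → ℂ, (∀ u, Normalized (χ' u)) ∧
          ∀ ψ : Bits V → ℂ, run s A (regState w χ ψ) =
            ((Real.sqrt 2 : ℂ)⁻¹ ^ numMeas A) •
              regState w' χ' ((MGate.unitary (G.map Prod.snd)).mulVec ψ)) := by
  induction G generalizing w with
  | nil =>
    refine ⟨w, [], hw, fun v => Or.inl ⟨v, rfl⟩, fun _ _ _ => trivial, by simp, by simp,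
      fun d e M _ _ h _ => h, fun s χ _ hN => ⟨χ, hN, fun ψ => ?_⟩⟩
    simp [numMeas, MGate.unitary]
  | cons g G ih =>
    obtain ⟨a, g⟩ := g
    simp only [List.map_cons, List.nodup_cons] at hG
    simp only [List.map_cons, List.forall_mem_cons] at hwG
    let fr : V × Bool → V × Option Λ × Bool := fun p => (p.1, some a, p.2)
    have hfr : Function.Injective fr := fun p q h => by
      simp only [fr, Prod.mk.injEq, true_and] at h
      exact Prod.ext h.1 h.2
    obtain ⟨w₁, A₁, h₁⟩ := exists_realizes g hw hfr fun v p h => (hwG v).1 (by rw [h])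
    -- the qubits used by the first gate carry either no later label or its own one
    have hS : ∀ u ∈ g.qubits.image w ∪ univ.image fr, ∀ b ∈ G.map Prod.fst, u.2.1 ≠ some b := by
      intro u hu b hb hub
      rcases mem_union.1 hu with h | h
      · obtain ⟨v, -, rfl⟩ := mem_image.1 h
        exact (hwG v).2 b hb hub
      · obtain ⟨p, -, rfl⟩ := mem_image.1 h
        obtain rfl : a = b := by simpa [fr] using hub
        exact hG.1 hb
    have hw₁ : ∀ v, w₁ v = w v ∨ w₁ v ∈ g.qubits.image w ∪ univ.image fr := fun v => by
      by_cases hv : v ∈ g.qubits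
      · exact Or.inr (h₁.wire_mem v hv)
      · exact Or.inl (h₁.wire_of_notMem v hv)
    have hw₁G : ∀ v, ∀ b ∈ G.map Prod.fst, (w₁ v).2.1 ≠ some b := fun v b hb => by
      rcases hw₁ v with h | h
      · rw [h]; exact (hwG v).2 b hb
      · exact hS _ h b hb
    have hmeas : measuredSet A₁ ⊆ g.qubits.image w ∪ univ.image fr := fun u hu => by
      obtain ⟨p, hp, hu⟩ := mem_measuredSet.1 hu
      exact h₁.dom_subset p hp (qubits_subset_dom p (measured_subset_qubits p hu))
    have hw₁m : ∀ v, w₁ v ∉ measuredSet A₁ := fun v hv => by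
      obtain ⟨p, hp, hu⟩ := mem_measuredSet.1 hv
      exact h₁.measured_notMem p hp v hu
    obtain ⟨w', A₂, i1, i2, i3, i4, i5, i6, i7⟩ := ih hG.2 h₁.inj hw₁G
    refine ⟨w', A₁ ++ A₂, i1, fun v => ?_, fun m hm hmG => ?_, fun v hv => ?_, ?_, ?_, ?_⟩
    · rcases i2 v with ⟨v', hv'⟩ | ⟨b, hb, h⟩
      · rw [← hv']
        rcases hw₁ v' with h | h
        · exact Or.inl ⟨v', h.symm⟩
        · rcases mem_union.1 h with h | h
          · obtain ⟨v'', -, h⟩ := mem_image.1 h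
            exact Or.inl ⟨v'', h⟩
          · obtain ⟨p, -, h⟩ := mem_image.1 h
            exact Or.inr ⟨a, by simp, by rw [← h]⟩
      · exact Or.inr ⟨b, by simp only [List.map_cons]; exact List.mem_cons_of_mem _ hb, h⟩
    · simp only [List.map_cons, List.forall_mem_cons] at hmG
      have hd : Disjoint m (g.qubits.image w ∪ univ.image fr) := by
        rw [disjoint_left]
        intro u hu hu'
        rcases mem_union.1 hu' with h | h
        · obtain ⟨v, -, rfl⟩ := mem_image.1 h
          exact hm v hu
        · obtain ⟨p, -, rfl⟩ := mem_image.1 h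
          exact (hmG _ hu).1 rfl
      refine runnable_append.2 ⟨h₁.runnable m hd, i3 _ (fun v hv => ?_) fun u hu b hb => ?_⟩
      · rcases mem_union.1 hv with h | h
        · rcases hw₁ v with h' | h'
          · exact hm v (h' ▸ h)
          · exact disjoint_left.1 hd h h'
        · exact hw₁m v h
      · rcases mem_union.1 hu with h | h
        · exact (hmG u h).2 b hb
        · exact hS u (hmeas h) b hb
    · rw [measuredSet_append, mem_union] at hv
      rcases hv with hv | hv
      · rcases i2 v with ⟨v', hv'⟩ | ⟨b, hb, h⟩
        · exact hw₁m v' (hv' ▸ hv)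
        · exact hS _ (hmeas hv) b hb h
      · exact i4 v hv
    · have := h₁.size_le
      simp only [List.map_append, List.sum_append, List.map_cons, List.sum_cons]
      omega
    · intro d e M hd hfree hM he u
      rw [List.map_cons, busy_cons] at he
      simp only [List.map_cons, List.forall_mem_cons] at hfree
      obtain ⟨Ls, hLs, hlen, hind⟩ := h₁.layers
      have hB : ∀ u ∈ g.qubits.image w ∪ univ.image fr,
          busy Command.qubits Command.dom d A₁ u ≤ 7 * (g.qubits.sup e + 1) := by
        intro u hu
        rw [hLs]
        refine (busy_layers (B := 7 * g.qubits.sup e) hind (fun l hl p hp => h₁.dom_subset p ?_)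
          (fun u hu => ?_) hu).trans (by omega)
        · rw [hLs]; exact List.mem_flatten.2 ⟨l, hl, hp⟩
        · rcases mem_union.1 hu with h | h
          · obtain ⟨v, hv, rfl⟩ := mem_image.1 h
            exact (hd v).trans (Nat.mul_le_mul_left _ (le_sup (f := e) hv))
          · obtain ⟨p, -, rfl⟩ := mem_image.1 h
            simp [(hfree (fr p)).1 rfl]
      have hO : ∀ u ∉ g.qubits.image w ∪ univ.image fr,
          busy Command.qubits Command.dom d A₁ u = d u := fun u hu =>
        busy_of_notMem fun p hp h => hu (h₁.dom_subset p hp (qubits_subset_dom p h))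
      have hgM : g.qubits.sup e + 1 ≤ M := by
        obtain ⟨v, hv⟩ : g.qubits.Nonempty := by cases g <;> simp [MGate.qubits]
        have := (le_busy (fun _ => Subset.rfl) _ _ v).trans (he v)
        rwa [if_pos hv] at this
      rw [busy_append]
      refine i6 _ _ M (fun v => ?_) (fun u b hb hub => ?_) (fun u => ?_) he u
      · by_cases hv : v ∈ g.qubits
        · rw [if_pos hv]; exact hB _ (h₁.wire_mem v hv)
        · rw [if_neg hv, h₁.wire_of_notMem v hv, hO]
          · exact hd v
          · intro h
            rcases mem_union.1 h with h | h
            · obtain ⟨v', hv', h⟩ := mem_image.1 h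
              exact hv (hw h ▸ hv')
            · obtain ⟨p, -, h⟩ := mem_image.1 h
              exact (hwG v).1 (by rw [← h])
      · rw [hO _ fun h => hS u h b hb hub]
        exact (hfree u).2 b hb hub
      · by_cases hu : u ∈ g.qubits.image w ∪ univ.image fr
        · exact (hB u hu).trans (Nat.mul_le_mul_left _ hgM)
        · rw [hO u hu]; exact hM u
    · intro s χ hχ hN
      simp only [List.map_cons, List.forall_mem_cons] at hχ
      obtain ⟨χ₁, n1, n2, n3⟩ := h₁.sem s χ (fun u hu => by
        obtain ⟨p, -, rfl⟩ := mem_image.1 hu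
        exact (hχ _).1 rfl) hN
      obtain ⟨χ', m1, m2⟩ := i7 s χ₁ (fun u b hb hub => by
        rw [n2 u fun h => hS u h b hb hub]
        exact (hχ u).2 b hb hub) n1
      refine ⟨χ', m1, fun ψ => ?_⟩
      rw [run_append, n3, run_smul, m2, smul_smul, numMeas_append, pow_add, List.map_cons,
        MGate.unitary_cons, Matrix.mulVec_mulVec]

end Compile

/-! ### Partial traces and the channel of a pattern -/

lemma sum_prod_bits {Z : Type*} [Fintype Z] [DecidableEq Z] (h : Z → Fin 2 → ℂ) :
    ∑ z : Bits Z, ∏ u, h u (z u) = ∏ u, ∑ b, h u b := by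
  rw [prod_univ_sum, Fintype.piFinset_univ]

/-- The qubits outside the range of `j`, each with weights of sum `1`, can be summed over. -/
lemma sum_comp_mul_prod {P Z : Type*} [Fintype P] [DecidableEq P] [Fintype Z] [DecidableEq Z]
    {j : P → Z} (hj : Function.Injective j) {h : Z → Fin 2 → ℂ} (hh : ∀ u, ∑ b, h u b = 1)
    (F : Bits P → ℂ) :
    ∑ z : Bits Z, F (fun p => z (j p)) * ∏ u ∈ (univ.image j)ᶜ, h u (z u) = ∑ z, F z := by
  classical
  let p : Z → Prop := fun u => u ∈ Set.range j
  have h1 : ∀ z : Bits Z, ∏ u ∈ (univ.image j)ᶜ, h u (z u) =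
      ∏ u : {u // ¬ p u}, h u (z u) := fun z =>
    prod_subtype _ (fun u => by simp [p]) _
  simp only [h1]
  rw [Fintype.sum_equiv (Equiv.piEquivPiSubtypeProd p fun _ => Fin 2) _
    (fun q : ({u // p u} → Fin 2) × ({u // ¬ p u} → Fin 2) =>
      F (fun i => q.1 ⟨j i, i, rfl⟩) * ∏ u : {u // ¬ p u}, h u (q.2 u)),
    Fintype.sum_prod_type]
  swap
  · exact fun z => rfl
  simp only [← mul_sum]
  rw [sum_prod_bits fun u : {u // ¬ p u} => h u]
  simp only [hh, prod_const_one, mul_one]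
  exact Fintype.sum_equiv ((Equiv.ofInjective j hj).symm.arrowCongr (Equiv.refl _)) _ _
    fun z => rfl

section Channel

variable {V : Type*} [Fintype V] [DecidableEq V] {W : Type*} [Fintype W] [DecidableEq W]

/-- The number of branches of a pattern that measures the qubits `M`. -/
lemma card_outcomes (M : Finset W) :
    #(univ.filter fun s : W → Fin 2 => ∀ v, v ∉ M → s v = 0) = 2 ^ #M := by
  have : (univ.filter fun s : W → Fin 2 => ∀ v, v ∉ M → s v = 0) =
      Fintype.piFinset fun v => if v ∈ M then (univ : Finset (Fin 2)) else {0} := by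
    ext s
    simp only [mem_filter, mem_univ, true_and, Fintype.mem_piFinset]
    refine forall_congr' fun v => ?_
    by_cases h : v ∈ M <;> simp [h]
  rw [this, Fintype.card_piFinset]
  have h2 : ∀ v, #(if v ∈ M then (univ : Finset (Fin 2)) else {0}) = if v ∈ M then 2 else 1 :=
    fun v => by split_ifs <;> simp
  simp only [h2]
  simp

/-- The initial state of a pattern: the register in its own initial state, the other qubits in the
state `k`. -/
lemma prep_map (k : Fin 2 → ℂ) (I : Finset V) (w : V ↪ W) (x : Bits W) (y : Bits (I.map w)) :
    prep k (I.map w) x y =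
      prep k I (fun v => x (w v)) (fun i => y (equivMap w I i)) *
        ∏ u ∈ (univ.image w)ᶜ, k (x u) := by
  have h1 : ((fun i : (I.map w : Finset W) => x i) = y) ↔
      (fun i : I => x (w i)) = fun i => y (equivMap w I i) := by
    constructor
    · rintro rfl; rfl
    · intro h
      ext i
      obtain ⟨i, rfl⟩ := (equivMap w I).surjective i
      exact congrArg Fin.val (congrFun h i)
  have h2 : (I.map w)ᶜ = Iᶜ.map w ∪ (univ.image w)ᶜ := by
    ext u
    simp only [mem_compl, mem_map, mem_union, mem_image, mem_univ, true_and]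
    constructor
    · intro h
      by_cases hu : ∃ v, w v = u
      · obtain ⟨v, rfl⟩ := hu
        exact Or.inl ⟨v, fun hv => h ⟨v, hv, rfl⟩, rfl⟩
      · exact Or.inr hu
    · rintro (⟨v, hv, rfl⟩ | h) ⟨v', hv', h'⟩
      · exact hv (w.injective h' ▸ hv')
      · exact h ⟨v', h'⟩
  have h3 : Disjoint (Iᶜ.map w) (univ.image w)ᶜ := by
    rw [disjoint_left]
    intro u hu
    obtain ⟨v, -, rfl⟩ := mem_map.1 hu
    simp
  simp only [prep, Matrix.of_apply, h1, h2, prod_union h3, prod_map, ite_mul, zero_mul]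

omit [Fintype W] in
lemma glue_of_notMem {O : Finset W} (x : Bits O) (z : Bits {v : W // v ∉ O}) {v : W}
    (hv : v ∉ O) : glue O x z v = z ⟨v, hv⟩ := dif_neg hv

omit [Fintype W] in
lemma glue_of_mem {O : Finset W} (x : Bits O) (z : Bits {v : W // v ∉ O}) {v : W}
    (hv : v ∈ O) : glue O x z v = x ⟨v, hv⟩ := dif_pos hv

/-- A pattern that, in every branch, applies `U` to its register and leaves the other qubits in a
product state, has the channel of `U`: the branches have equal weights `2^{-n}`, where `n` is the
number of measurements, and there are `2^n` of them. -/
lemma simulates_of_run {I O : Finset V} {w w' : V ↪ W} {A : List (Command W)} {U : Op V}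
    (hA : Command.Runnable ∅ A)
    (hU : ∀ s : W → Fin 2, ∃ χ : W → Fin 2 → ℂ, (∀ u, Normalized (χ u)) ∧ ∀ ψ : Bits V → ℂ,
      run s A (regState w (fun _ => ketPM 0 0) ψ) =
        ((Real.sqrt 2 : ℂ)⁻¹ ^ numMeas A) • regState w' χ (U.mulVec ψ)) :
    (⟨I.map w, O.map w', A⟩ : Pattern W).Simulates fun ρ : Op I =>
      traceOut O (U * prep (ketPM 0 0) I * ρ * (U * prep (ketPM 0 0) I).conjTranspose) := by
  refine ⟨equivMap w I, equivMap w' O, fun ρ => ?_⟩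
  set N := U * prep (ketPM 0 0) I with hN
  set r : ℂ := (Real.sqrt 2 : ℂ)⁻¹ with hr
  choose χ hχ hrun using hU
  let σ : Bits (I.map w) ≃ Bits I := (equivMap w I).symm.arrowCongr (Equiv.refl _)
  let π : Bits W → Bits V := fun x v => x (w' v)
  let α : (W → Fin 2) → Bits W → ℂ := fun s x =>
    r ^ numMeas A * ∏ u ∈ (univ.image w')ᶜ, χ s u (x u)
  have hK : ∀ s, (⟨I.map w, O.map w', A⟩ : Pattern W).branch s * prep (ketPM 0 0) (I.map w) =
      Matrix.diagonal (α s) * N.submatrix π σ := by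
    intro s
    ext x y
    have h1 : ((⟨I.map w, O.map w', A⟩ : Pattern W).branch s * prep (ketPM 0 0) (I.map w)) x y =
        ((⟨I.map w, O.map w', A⟩ : Pattern W).branch s).mulVec
          (fun x => prep (ketPM 0 0) (I.map w) x y) x := rfl
    have h2 : (fun x => prep (ketPM 0 0) (I.map w) x y) =
        regState w (fun _ => ketPM 0 0) fun v => prep (ketPM 0 0) I v (σ y) := by
      ext x
      exact prep_map _ _ _ _ _
    rw [h1, Pattern.branch, foldl_op_mulVec, Matrix.one_mulVec, h2, hrun,
      Matrix.diagonal_mul, Pi.smul_apply, regState, smul_eq_mul]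
    have h3 : U.mulVec (fun v => prep (ketPM 0 0) I v (σ y)) (fun v => x (w' v)) =
        N (π x) (σ y) := rfl
    rw [h3, Matrix.submatrix_apply]
    ring
  have hX : ∀ s, (⟨I.map w, O.map w', A⟩ : Pattern W).branch s * prep (ketPM 0 0) (I.map w) *
      ρ.submatrix σ σ * ((⟨I.map w, O.map w', A⟩ : Pattern W).branch s *
        prep (ketPM 0 0) (I.map w)).conjTranspose =
      Matrix.diagonal (α s) * (N * ρ * N.conjTranspose).submatrix π π *
        Matrix.diagonal (star (α s)) := by
    intro s
    rw [hK, Matrix.conjTranspose_mul, Matrix.diagonal_conjTranspose, Matrix.conjTranspose_submatrix,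
      Matrix.mul_assoc (Matrix.diagonal (α s)), Matrix.submatrix_mul_equiv, ← Matrix.mul_assoc,
      Matrix.mul_assoc (Matrix.diagonal (α s)), Matrix.submatrix_mul_equiv]
  have hχ' : ∀ s u, ∑ b, χ s u b * star (χ s u b) = 1 := hχ
  ext x x'
  let j : {v : V // v ∉ O} → {u : W // u ∉ O.map w'} := fun v => ⟨w' v, by simpa using v.2⟩
  have hj : Function.Injective j := fun a b h =>
    Subtype.ext (w'.injective (congrArg Subtype.val h))
  have hcompl : ((univ.image j)ᶜ).map (Function.Embedding.subtype _) = (univ.image w')ᶜ := by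
    ext u
    simp only [mem_map, mem_compl, mem_image, mem_univ, true_and, Function.Embedding.subtype_apply,
      Subtype.exists, exists_and_right, exists_eq_right]
    constructor
    · rintro ⟨h1, h2⟩ ⟨v, rfl⟩
      exact h2 ⟨v, fun h => h1 ⟨v, h, rfl⟩, rfl⟩
    · intro h
      refine ⟨fun h1 => ?_, ?_⟩
      · obtain ⟨v, -, rfl⟩ := h1
        exact h ⟨v, rfl⟩
      · rintro ⟨v, hv, h2⟩
        exact h ⟨v, congrArg Subtype.val h2⟩
  have hglue : ∀ (x : Bits (O.map w')) z, π (glue (O.map w') x z) =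
      glue O (fun o => x (equivMap w' O o)) fun v => z (j v) := by
    intro x z
    ext v
    by_cases hv : v ∈ O
    · simp only [π]
      rw [glue_of_mem _ _ hv, glue_of_mem _ _ (mem_map_of_mem w' hv)]
      rfl
    · simp only [π]
      rw [glue_of_notMem _ _ hv, glue_of_notMem _ _ (by simpa using hv)]
  have hprod : ∀ s (x : Bits (O.map w')) z, ∏ u ∈ (univ.image w')ᶜ,
      χ s u (glue (O.map w') x z u) = ∏ u ∈ (univ.image j)ᶜ, χ s u (z u) := by
    intro s x z
    rw [← hcompl, prod_map]
    exact prod_congr rfl fun u _ => by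
      rw [Function.Embedding.subtype_apply, glue_of_notMem x z u.2]
  have hrr : r * star r = 2⁻¹ := by
    rw [hr, star_inv₀, Complex.star_def, Complex.conj_ofReal, inv_sqrt_two_mul_self]
  have hs : ∀ s, traceOut (O.map w') (Matrix.diagonal (α s) *
      (N * ρ * N.conjTranspose).submatrix π π * Matrix.diagonal (star (α s))) x x' =
      2⁻¹ ^ numMeas A * traceOut O (N * ρ * N.conjTranspose)
        (fun o => x (equivMap w' O o)) fun o => x' (equivMap w' O o) := by
    intro s
    simp only [traceOut, Matrix.of_apply, Matrix.mul_diagonal, Matrix.diagonal_mul,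
      Matrix.submatrix_apply, hglue, α, Pi.star_apply, hprod]
    rw [← sum_comp_mul_prod hj (h := fun u b => χ s u b * star (χ s u b)) (fun u => hχ' s u),
      mul_sum]
    refine sum_congr rfl fun z _ => ?_
    rw [prod_mul_distrib, ← hrr, star_mul', star_pow, star_prod, mul_pow]
    ring
  have hm : (⟨I.map w, O.map w', A⟩ : Pattern W).measured = measuredSet A := rfl
  simp only [Pattern.channel]
  change (∑ s : W → Fin 2 with ∀ v, v ∉ (⟨I.map w, O.map w', A⟩ : Pattern W).measured → s v = 0,
    traceOut (O.map w') ((⟨I.map w, O.map w', A⟩ : Pattern W).branch s *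
      prep (ketPM 0 0) (I.map w) * ρ.submatrix σ σ *
      ((⟨I.map w, O.map w', A⟩ : Pattern W).branch s *
        prep (ketPM 0 0) (I.map w)).conjTranspose)) x x' = _
  simp only [hX, hm]
  rw [Matrix.sum_apply]
  simp only [hs]
  rw [sum_const, card_outcomes, (card_measuredSet hA).2, nsmul_eq_mul, ← mul_assoc]
  push_cast
  rw [← mul_pow, mul_inv_cancel₀ two_ne_zero, one_pow, one_mul]
  rfl

end Channel

/-! ### Final measurements -/

section FinalMeasurements

variable {V : Type*} [Fintype V] [DecidableEq V]

lemma sum_flip (v : V) (f : Bits V → ℂ) :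
    ∑ z : Bits V, f (Function.update z v (z v + 1)) = ∑ z, f z := by
  have h : Function.Involutive fun z : Bits V => Function.update z v (z v + 1) := fun z => by
    have : ∀ a : Fin 2, a + 1 + 1 = a := by decide
    simp [this]
  exact Equiv.sum_comp (h.toPerm _) f

lemma sum_sum_update (v : V) (f : Bits V → ℂ) :
    ∑ z : Bits V, ∑ b, f (Function.update z v b) = 2 * ∑ z, f z := by
  have h : ∀ z : Bits V, ∑ b, f (Function.update z v b) =
      f z + f (Function.update z v (z v + 1)) := fun z => by
    have h2 : ∀ (a : Fin 2) (g : Fin 2 → ℂ), ∑ b, g b = g a + g (a + 1) := fun a g => by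
      fin_cases a <;> simp [add_comm]
    rw [h2 (z v) fun b => f (Function.update z v b), Function.update_eq_self]
  simp only [h, sum_add_distrib, sum_flip]
  ring

/-- The coordinates on which `F` does not depend can be averaged over. -/
lemma sum_mul_prod_of_free (M : Finset V) {F : Bits V → ℂ} (hF : ∀ v ∈ M, Free v F)
    (h : V → Fin 2 → ℂ) :
    ∑ z : Bits V, F z * ∏ v ∈ M, h v (z v) = (∏ v ∈ M, (∑ b, h v b) / 2) * ∑ z, F z := by
  induction M using Finset.cons_induction generalizing F with
  | empty => simp
  | cons v M hv ih =>
    have h1 : ∀ z : Bits V, F z * ∏ u ∈ cons v M hv, h u (z u) =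
        (F z * h v (z v)) * ∏ u ∈ M, h u (z u) := fun z => by rw [prod_cons]; ring
    simp only [h1]
    rw [ih fun u hu => (hF u (mem_cons_of_mem hu)).mul (free_coord (by rintro rfl; exact hv hu) _),
      prod_cons, mul_comm ((∑ b, h v b) / 2), mul_assoc]
    congr 1
    have h2 := sum_sum_update v fun z => F z * h v (z v)
    simp only [hF v (mem_cons_self v M) _ _, Function.update_self, ← mul_sum, ← sum_mul] at h2
    linear_combination -h2 / 2

omit [Fintype V] in
lemma update_glue {O : Finset V} (x : Bits O) (z : Bits {v : V // v ∉ O}) {u : V} (hu : u ∉ O)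
    (b : Fin 2) : Function.update (glue O x z) u b = glue O x (Function.update z ⟨u, hu⟩ b) := by
  ext v
  by_cases hv : v = u
  · subst hv; rw [glue_of_notMem _ _ hu]; simp
  · rw [Function.update_of_ne hv]
    by_cases hv' : v ∈ O
    · simp [glue_of_mem _ _ hv']
    · rw [glue_of_notMem _ _ hv', glue_of_notMem _ _ hv', Function.update_of_ne]
      simpa using hv

lemma onQubit_conj_apply (A : Matrix (Fin 2) (Fin 2) ℂ) (u : V) (X : Op V) (p p' : Bits V) :
    (onQubit A u * X * (onQubit A u).conjTranspose) p p' =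
      ∑ c, ∑ c', A (p u) c * X (Function.update p u c) (Function.update p' u c') *
        star (A (p' u) c') := by
  have h1 : ∀ (X : Op V) p p', (onQubit A u * X) p p' =
      ∑ c, A (p u) c * X (Function.update p u c) p' := fun X p p' =>
    onQubit_mulVec A u (fun x => X x p') p
  have h2 : (onQubit A u * X * (onQubit A u).conjTranspose) p p' =
      star ((onQubit A u * (onQubit A u * X).conjTranspose) p' p) := by
    rw [← Matrix.conjTranspose_apply, Matrix.conjTranspose_mul, Matrix.conjTranspose_conjTranspose]
  rw [h2, h1, star_sum, sum_comm]
  refine sum_congr rfl fun c' _ => ?_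
  rw [Matrix.conjTranspose_apply, h1, star_mul', star_star, mul_sum]
  exact sum_congr rfl fun c _ => by ring

lemma sum_projPM_mul_star (a c c' : Fin 2) :
    ∑ b, projPM 0 b a c * star (projPM 0 b a c') = if c = c' then 2⁻¹ else 0 := by
  have h := inv_sqrt_two_mul_self
  simp only [projPM, Matrix.vecMulVec_apply, Pi.star_apply, star_mul', star_star, ketPM,
    Fin.sum_univ_two]
  fin_cases a <;> fin_cases c <;> fin_cases c' <;> simp <;>
    linear_combination 2 * (↑√2)⁻¹ * (↑√2)⁻¹ * h + h

/-- Measuring a qubit that is traced out does not matter. -/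
lemma sum_traceOut_projPM {O : Finset V} {u : V} (hu : u ∉ O) (X : Op V) :
    ∑ b, traceOut O (onQubit (projPM 0 b) u * X * (onQubit (projPM 0 b) u).conjTranspose) =
      traceOut O X := by
  ext x x'
  rw [Matrix.sum_apply]
  simp only [traceOut, Matrix.of_apply, onQubit_conj_apply, glue_of_notMem _ _ hu,
    update_glue _ _ hu]
  rw [sum_comm]
  have h : ∀ z : Bits {v : V // v ∉ O}, ∑ b, ∑ c, ∑ c', projPM 0 b (z ⟨u, hu⟩) c *
      X (glue O x (Function.update z ⟨u, hu⟩ c)) (glue O x' (Function.update z ⟨u, hu⟩ c')) *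
      star (projPM 0 b (z ⟨u, hu⟩) c') = ∑ c, 2⁻¹ *
        X (glue O x (Function.update z ⟨u, hu⟩ c)) (glue O x' (Function.update z ⟨u, hu⟩ c)) := by
    intro z
    rw [sum_comm]
    refine sum_congr rfl fun c _ => ?_
    rw [sum_comm]
    have : ∀ c', ∑ b, projPM 0 b (z ⟨u, hu⟩) c *
        X (glue O x (Function.update z ⟨u, hu⟩ c)) (glue O x' (Function.update z ⟨u, hu⟩ c')) *
        star (projPM 0 b (z ⟨u, hu⟩) c') = (if c = c' then 2⁻¹ else 0) *
        X (glue O x (Function.update z ⟨u, hu⟩ c))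
          (glue O x' (Function.update z ⟨u, hu⟩ c')) := fun c' => by
      rw [← sum_projPM_mul_star (z ⟨u, hu⟩), sum_mul]
      exact sum_congr rfl fun b _ => by ring
    simp only [this, ite_mul, zero_mul, sum_ite_eq, mem_univ, if_true]
  simp only [h, ← mul_sum]
  rw [sum_sum_update (⟨u, hu⟩ : {v : V // v ∉ O}) fun z => X (glue O x z) (glue O x' z)]
  ring

/-- The operators of a runnable sequence depend on the outcomes of its own measurements only. -/
lemma op_congr_of_runnable {m : Finset V} {l : List (Command V)}
    (h : Command.Runnable m l) {s s' : V → Fin 2} (hs : ∀ v ∈ m ∪ measuredSet l, s v = s' v) :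
    ∀ p ∈ l, p.op s = p.op s' := by
  induction l generalizing m with
  | nil => simp
  | cons p l ih =>
    obtain ⟨-, h2, h3⟩ := h
    rw [measuredSet_cons, ← union_assoc] at hs
    rw [List.forall_mem_cons]
    refine ⟨?_, ih h3 hs⟩
    have hsig : ∀ v ∈ p.signals, s v = s' v := fun v hv =>
      hs v (mem_union_left _ (mem_union_left _ (h2 hv)))
    have hmeas : ∀ v ∈ p.measured, s v = s' v := fun v hv =>
      hs v (mem_union_left _ (mem_union_right _ hv))
    cases p with
    | E i j hij => rfl
    | M α i => simp only [Command.op]; rw [hmeas i (by simp [Command.measured])]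
    | X i σ =>
      simp only [Command.op]
      rw [show ∑ j ∈ σ, s j = ∑ j ∈ σ, s' j from sum_congr rfl hsig]
    | Z i σ =>
      simp only [Command.op]
      rw [show ∑ j ∈ σ, s j = ∑ j ∈ σ, s' j from sum_congr rfl hsig]

/-- Measuring one more qubit that is not an output leaves the channel unchanged. -/
lemma channel_append_M {I O : Finset V} {A : List (Command V)} (hA : Command.Runnable ∅ A)
    {u : V} (huO : u ∉ O) (huA : u ∉ measuredSet A) :
    (⟨I, O, A ++ [Command.M 0 u]⟩ : Pattern V).channel = (⟨I, O, A⟩ : Pattern V).channel := by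
  funext ρ
  let B : (V → Fin 2) → Op V := fun s => A.foldl (fun U p => p.op s * U) 1
  have hB : ∀ s s' : V → Fin 2, (∀ v ∈ measuredSet A, s v = s' v) → B s = B s' := by
    intro s s' h
    refine List.foldl_ext _ _ _ fun U p hp => ?_
    rw [op_congr_of_runnable hA (by simpa using h) p hp]
  let X : (V → Fin 2) → Op V := fun s =>
    B s * prep (ketPM 0 0) I * ρ * (B s * prep (ketPM 0 0) I).conjTranspose
  have hm : (⟨I, O, A ++ [Command.M 0 u]⟩ : Pattern V).measured = insert u (measuredSet A) := by
    have : (⟨I, O, A ++ [Command.M 0 u]⟩ : Pattern V).measured =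
      measuredSet (A ++ [Command.M 0 u]) := rfl
    rw [this, measuredSet_append, measuredSet_cons]
    simp [Command.measured, union_comm]
  have hbr : ∀ s, (⟨I, O, A ++ [Command.M 0 u]⟩ : Pattern V).branch s =
      onQubit (projPM 0 (s u)) u * B s := fun s => by
    simp [Pattern.branch, List.foldl_append, Command.op, B]
  have hX : ∀ s, traceOut O ((⟨I, O, A ++ [Command.M 0 u]⟩ : Pattern V).branch s *
      prep (ketPM 0 0) I * ρ * ((⟨I, O, A ++ [Command.M 0 u]⟩ : Pattern V).branch s *
        prep (ketPM 0 0) I).conjTranspose) =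
      traceOut O (onQubit (projPM 0 (s u)) u * X s *
        (onQubit (projPM 0 (s u)) u).conjTranspose) := fun s => by
    rw [hbr]
    simp only [X, Matrix.conjTranspose_mul, Matrix.mul_assoc]
  change ∑ s : V → Fin 2 with ∀ v, v ∉ (⟨I, O, A ++ [Command.M 0 u]⟩ : Pattern V).measured →
    s v = 0, traceOut O ((⟨I, O, A ++ [Command.M 0 u]⟩ : Pattern V).branch s *
      prep (ketPM 0 0) I * ρ * ((⟨I, O, A ++ [Command.M 0 u]⟩ : Pattern V).branch s *
        prep (ketPM 0 0) I).conjTranspose) =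
    ∑ s : V → Fin 2 with ∀ v, v ∉ measuredSet A → s v = 0, traceOut O (X s)
  simp only [hX, hm]
  simp only [← sum_traceOut_projPM huO (X _)]
  rw [← sum_product']
  symm
  refine sum_bij' (fun q _ => Function.update q.1 u q.2)
    (fun s _ => (Function.update s u 0, s u)) ?_ ?_ ?_ ?_ ?_
  · rintro ⟨s, b⟩ hs
    simp only [mem_product, mem_filter, mem_univ, true_and, and_true, mem_insert, not_or] at hs ⊢
    exact fun v hv => by rw [Function.update_of_ne hv.1]; exact hs v hv.2
  · intro s hs
    simp only [mem_product, mem_filter, mem_univ, true_and, and_true, mem_insert, not_or] at hs ⊢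
    intro v hv
    by_cases h : v = u
    · subst h; simp
    · rw [Function.update_of_ne h]; exact hs v ⟨h, hv⟩
  · rintro ⟨s, b⟩ hs
    simp only [mem_product, mem_filter, mem_univ, true_and, and_true] at hs
    simp [← hs u huA]
  · intro s _
    simp
  · rintro ⟨s, b⟩ -
    have : X (Function.update s u b) = X s := by
      simp only [X]
      rw [hB (Function.update s u b) s fun v hv => by
        rw [Function.update_of_ne]; rintro rfl; exact huA hv]
    simp [this]

lemma channel_append_map_M {I O : Finset V} {A : List (Command V)} (hA : Command.Runnable ∅ A)
    {L : List V} (hL : L.Nodup) (hLO : ∀ u ∈ L, u ∉ O) (hLA : ∀ u ∈ L, u ∉ measuredSet A) :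
    Command.Runnable ∅ (A ++ L.map (Command.M 0)) ∧
      (⟨I, O, A ++ L.map (Command.M 0)⟩ : Pattern V).channel =
        (⟨I, O, A⟩ : Pattern V).channel := by
  induction L generalizing A with
  | nil =>
    have : ∀ B, B = A → Command.Runnable ∅ B ∧
        (⟨I, O, B⟩ : Pattern V).channel = (⟨I, O, A⟩ : Pattern V).channel := by
      rintro _ rfl; exact ⟨hA, rfl⟩
    exact this _ (by simp)
  | cons u L ih =>
    rw [List.nodup_cons] at hL
    simp only [List.forall_mem_cons] at hLO hLA
    have h1 : Command.Runnable ∅ (A ++ [Command.M 0 u]) := runnable_append.2 ⟨hA, by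
      simp [Command.Runnable, Command.qubits, Command.signals, hLA.1]⟩
    have h2 : A ++ (u :: L).map (Command.M 0) = (A ++ [Command.M 0 u]) ++ L.map (Command.M 0) := by
      simp
    obtain ⟨h3, h4⟩ := ih h1 hL.2 hLO.2 fun v hv => by
      rw [measuredSet_append, measuredSet_cons]
      have : v ≠ u := by rintro rfl; exact hL.1 hv
      simp [Command.measured, hLA.2 v hv, this]
    rw [h2]
    exact ⟨h3, h4.trans (channel_append_M hA hLO.1 hLA.1)⟩

lemma card_touched_le {α : Type*} (q : α → Finset V) (l : List α) :
    #(univ.filter fun v => ∃ p ∈ l, v ∈ q p) ≤ (l.map fun p => #(q p)).sum := by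
  induction l with
  | nil => simp
  | cons p l ih =>
    have : (univ.filter fun v => ∃ r ∈ p :: l, v ∈ q r) =
        q p ∪ univ.filter fun v => ∃ r ∈ l, v ∈ q r := by
      ext v; simp
    rw [this, List.map_cons, List.sum_cons]
    exact (card_union_le _ _).trans (Nat.add_le_add_left ih _)

/-- A runnable sequence of commands that measures no output is completed to a well-formed pattern
by measuring the remaining non-output qubits. -/
lemma exists_wellFormed (I O : Finset V) {A : List (Command V)} (hA : Command.Runnable ∅ A)
    (hO : Disjoint O (measuredSet A)) :
    ∃ A' : List (Command V), (⟨I, O, A'⟩ : Pattern V).WellFormed ∧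
      (⟨I, O, A'⟩ : Pattern V).channel = (⟨I, O, A⟩ : Pattern V).channel ∧
      (A'.map fun p => #p.qubits).sum ≤ 2 * (A.map fun p => #p.qubits).sum ∧
      ∀ M, (∀ u, busy Command.qubits Command.dom 0 A u ≤ M) →
        ∀ u, busy Command.qubits Command.dom 0 A' u ≤ M + 1 := by
  let T : Finset V := (univ.filter fun v => ∃ p ∈ A, v ∈ p.qubits) \ (O ∪ measuredSet A)
  have hT : ∀ u ∈ T.toList, u ∉ O ∧ u ∉ measuredSet A := fun u hu => by
    have := (mem_sdiff.1 (mem_toList.1 hu)).2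
    simpa using this
  obtain ⟨h1, h2⟩ := channel_append_map_M (I := I) (O := O) hA T.nodup_toList
    (fun u hu => (hT u hu).1) fun u hu => (hT u hu).2
  have hmT : measuredSet (T.toList.map (Command.M 0)) = T := by
    ext; simp [mem_measuredSet, Command.measured]
  refine ⟨A ++ T.toList.map (Command.M 0), ⟨h1, ?_, ?_⟩, h2, ?_, fun M hM u => ?_⟩
  · change Disjoint O (measuredSet (A ++ T.toList.map (Command.M 0)))
    rw [measuredSet_append, hmT, disjoint_union_right]
    refine ⟨hO, disjoint_left.2 fun v hv hvT => ?_⟩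
    exact (mem_sdiff.1 hvT).2 (mem_union_left _ hv)
  · change ∀ p ∈ A ++ T.toList.map (Command.M 0), ∀ v ∈ p.qubits, v ∉ O →
      v ∈ measuredSet (A ++ T.toList.map (Command.M 0))
    rw [measuredSet_append, hmT]
    intro p hp v hv hvO
    rw [mem_union]
    by_cases hvA : v ∈ measuredSet A
    · exact Or.inl hvA
    · right
      rcases List.mem_append.1 hp with hp | hp
      · exact mem_sdiff.2 ⟨by simpa using ⟨p, hp, hv⟩, by simp [hvO, hvA]⟩
      · obtain ⟨u, hu, rfl⟩ := List.mem_map.1 hp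
        obtain rfl : v = u := by simpa [Command.qubits] using hv
        exact mem_toList.1 hu
  · have h3 : #T ≤ (A.map fun p => #p.qubits).sum :=
      (card_le_card sdiff_subset).trans (card_touched_le _ _)
    have h4 : ∀ v : V, #(Command.M 0 v).qubits = 1 := fun v => card_singleton v
    simp only [List.map_append, List.sum_append, List.map_map, Function.comp_def, h4,
      List.map_const', List.sum_replicate, length_toList, smul_eq_mul, mul_one]
    omega
  · rw [busy_append]
    refine busy_layer ?_ (fun r _ v _ => hM v) (Nat.le_succ_of_le (hM u))
    rw [List.pairwise_map]
    refine T.nodup_toList.imp fun h => ?_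
    simpa [Command.qubits, Command.dom, Command.signals] using h

end FinalMeasurements

/-! ### Product operators -/

section Tensor

variable {V : Type u} [Fintype V] [DecidableEq V]

/-- The tensor product of the one-qubit operators `A v`. -/
def tensorOp (A : V → Matrix (Fin 2) (Fin 2) ℂ) : Op V :=
  Matrix.of fun x y => ∏ v, A v (x v) (y v)

omit [DecidableEq V] in
lemma tensorOp_apply (A : V → Matrix (Fin 2) (Fin 2) ℂ) (x y : Bits V) :
    tensorOp A x y = ∏ v, A v (x v) (y v) := rfl

lemma tensorOp_mul (A B : V → Matrix (Fin 2) (Fin 2) ℂ) :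
    tensorOp A * tensorOp B = tensorOp fun v => A v * B v := by
  ext x y
  simp only [Matrix.mul_apply, tensorOp_apply, ← prod_mul_distrib]
  exact sum_prod_bits fun v b => A v (x v) b * B v b (y v)

omit [DecidableEq V] in
lemma tensorOp_one : tensorOp (fun _ : V => (1 : Matrix (Fin 2) (Fin 2) ℂ)) = 1 := by
  ext x y
  simp only [tensorOp_apply, Matrix.one_apply, prod_boole, mem_univ, true_implies, funext_iff]

lemma onQubit_eq_tensorOp (A : Matrix (Fin 2) (Fin 2) ℂ) (i : V) :
    onQubit A i = tensorOp (Function.update 1 i A) := by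
  ext x y
  rw [tensorOp_apply, ← mul_prod_erase univ _ (mem_univ i), Function.update_self]
  have : ∏ v ∈ univ.erase i, (Function.update (1 : V → Matrix (Fin 2) (Fin 2) ℂ) i A) v (x v) (y v)
      = ∏ v ∈ univ.erase i, if x v = y v then 1 else 0 :=
    prod_congr rfl fun v hv => by
      rw [Function.update_of_ne (ne_of_mem_erase hv), Pi.one_apply, Matrix.one_apply]
  rw [this, prod_boole, onQubit, Matrix.of_apply]
  simp

omit [DecidableEq V] in
lemma hadamardAll_eq : hadamardAll V = tensorOp fun _ => hadamard := rfl

lemma hadamard_mul_self : hadamard * hadamard = 1 := by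
  have h := inv_sqrt_two_mul_self
  ext a b
  fin_cases a <;> fin_cases b <;> simp [hadamard, Matrix.mul_apply] <;> linear_combination 2 * h

lemma hadamard_mul_rz_zero : hadamard * rz (-0) = hadamard := by
  have : rz (-0) = 1 := by
    ext a b
    fin_cases a <;> fin_cases b <;> simp [rz]
  rw [this, mul_one]

lemma unitary_map_J {L : List V} (hL : L.Nodup) :
    MGate.unitary (L.map (MGate.J 0)) = tensorOp fun v => if v ∈ L then hadamard else 1 := by
  induction L with
  | nil => simp [MGate.unitary, tensorOp_one]
  | cons i L ih =>
    rw [List.nodup_cons] at hL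
    rw [List.map_cons, MGate.unitary_cons, ih hL.2, MGate.op, hadamard_mul_rz_zero,
      onQubit_eq_tensorOp, tensorOp_mul]
    congr 1
    ext1 v
    by_cases h : v = i
    · subst h; simp [hL.1]
    · simp [h]

/-- The matrix entries of `H`: `√2⁻¹ (-1)^{ab}`. -/
lemma hadamard_apply (a b : Fin 2) : hadamard a b = (Real.sqrt 2 : ℂ)⁻¹ * sg a b := by
  fin_cases a <;> fin_cases b <;> simp [hadamard, sg]

lemma sum_hadamard_sg (a b c : Fin 2) :
    ∑ d, hadamard a d * sg c d * hadamard d b = if a = b + c then 1 else 0 := by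
  have h := inv_sqrt_two_mul_self
  simp only [hadamard_apply, Fin.sum_univ_two]
  fin_cases a <;> fin_cases b <;> fin_cases c <;> simp [sg] <;> linear_combination 2 * h

lemma fanOutOp_apply {k : V} {T : Finset V} (hk : k ∉ T) (x y : Bits V) :
    fanOutOp k T x y = if ∀ v, if v ∈ T then x v = y v + x k else x v = y v then 1 else 0 := by
  rw [fanOutOp, basisMap, Matrix.of_apply]
  congr 1
  rw [funext_iff, eq_iff_iff]
  constructor
  · intro h v
    have hxy : x k = y k := by simpa [hk] using h k
    have := h v
    split_ifs at this ⊢ with hv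
    · rw [this, hxy]
    · exact this
  · intro h v
    have hxy : x k = y k := by simpa [hk] using h k
    have := h v
    split_ifs at this ⊢ with hv
    · rw [this, hxy]
    · exact this

/-- Conjugating the targets by Hadamard gates turns the product of `ΛZ` gates with control `k` into
the fan-out gate. -/
lemma tensorOp_star_tensorOp {k : V} {T : Finset V} (hk : k ∉ T) :
    tensorOp (fun v => if v ∈ T then hadamard else 1) * (MGate.star k T hk).op *
      tensorOp (fun v => if v ∈ T then hadamard else 1) = fanOutOp k T := by
  ext x y
  rw [Matrix.mul_apply]
  simp only [MGate.op, Matrix.mul_diagonal, tensorOp_apply]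
  have h1 : ∀ z : Bits V, (∏ v, (if v ∈ T then hadamard else 1) (x v) (z v)) *
      (∏ j ∈ T, sg (z k) (z j)) * ∏ v, (if v ∈ T then hadamard else 1) (z v) (y v) =
      ∏ v, if v ∈ T then hadamard (x v) (z v) * sg (x k) (z v) * hadamard (z v) (y v) else
        (1 : Matrix (Fin 2) (Fin 2) ℂ) (x v) (z v) *
          (1 : Matrix (Fin 2) (Fin 2) ℂ) (z v) (y v) := by
    intro z
    by_cases hz : x k = z k
    · have h2 : ∏ j ∈ T, sg (z k) (z j) = ∏ v, if v ∈ T then sg (x k) (z v) else 1 := by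
        rw [prod_ite_mem, univ_inter, hz]
      rw [h2, ← prod_mul_distrib, ← prod_mul_distrib]
      refine prod_congr rfl fun v _ => ?_
      split_ifs <;> ring
    · have h2 : ∏ v, (if v ∈ T then hadamard else 1) (x v) (z v) = 0 :=
        prod_eq_zero (mem_univ k) (by simp [hk, hz])
      rw [h2, zero_mul, zero_mul]
      exact (prod_eq_zero (mem_univ k) (by simp [hk, hz])).symm
  simp only [h1]
  rw [sum_prod_bits fun v b => if v ∈ T then hadamard (x v) b * sg (x k) b * hadamard b (y v) else
        (1 : Matrix (Fin 2) (Fin 2) ℂ) (x v) b * (1 : Matrix (Fin 2) (Fin 2) ℂ) b (y v)]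
  have h2 : ∀ v, (∑ b, if v ∈ T then hadamard (x v) b * sg (x k) b * hadamard b (y v) else
      (1 : Matrix (Fin 2) (Fin 2) ℂ) (x v) b * (1 : Matrix (Fin 2) (Fin 2) ℂ) b (y v)) =
      if (if v ∈ T then x v = y v + x k else x v = y v) then 1 else 0 := by
    intro v
    by_cases hv : v ∈ T
    · simp only [hv, if_true, sum_hadamard_sg]
    · simp [hv, Matrix.one_apply]
  simp only [h2, prod_boole, mem_univ, true_implies, fanOutOp_apply hk]

/-- Hadamard gates exchange the control and the targets: the fan-out gate is the conjugate of the
parity gate. -/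
lemma fanOutOp_eq_conj_parityOp {k : V} {T : Finset V} (hk : k ∉ T) :
    fanOutOp k T = hadamardAll V * parityOp k T * hadamardAll V := by
  ext x y
  have h1 : ∀ z : Bits V, (hadamardAll V * parityOp k T) x z =
      ∏ v, hadamard (x v) (z v) * sg (if v ∈ T then x k else 0) (z v) := by
    intro z
    simp only [Matrix.mul_apply, parityOp, basisMap, Matrix.of_apply, mul_ite, mul_one, mul_zero,
      sum_ite_eq', mem_univ, if_true, hadamardAll, hadamard_apply, prod_mul_distrib]
    have h2 : ∏ v, sg (x v) (if v = k then z k + ∑ j ∈ T, z j else z v) =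
        (∏ v, sg (x v) (z v)) * ∏ j ∈ T, sg (x k) (z j) := by
      rw [← mul_prod_erase univ _ (mem_univ k), ← mul_prod_erase univ (fun v => sg (x v) (z v))
        (mem_univ k), if_pos rfl, sg_add_right, prod_sg T (x k)]
      rw [prod_congr rfl fun v hv => by rw [if_neg (ne_of_mem_erase hv)]]
      ring
    have h3 : ∏ v, sg (if v ∈ T then x k else 0) (z v) = ∏ j ∈ T, sg (x k) (z j) := by
      rw [← univ_inter T, ← prod_ite_mem]
      refine prod_congr rfl fun v _ => ?_
      split_ifs with h4 h5 h5 <;> simp_all [sg]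
    rw [h2, h3, mul_assoc]
  rw [Matrix.mul_apply, fanOutOp_apply hk]
  simp only [h1]
  simp only [hadamardAll, Matrix.of_apply, ← prod_mul_distrib]
  rw [sum_prod_bits fun v b => hadamard (x v) b * sg (if v ∈ T then x k else 0) b *
    hadamard b (y v)]
  simp only [sum_hadamard_sg, prod_boole, mem_univ, true_implies]
  congr 1
  refine propext (forall_congr' fun v => ?_)
  split_ifs <;> simp

end Tensor

/-! ### Untouched qubits -/

section Untouched

variable {V : Type u} [Fintype V] [DecidableEq V]

lemma Free.op_mulVec {g : MGate V} {v : V} (hv : v ∉ g.qubits) {f : Bits V → ℂ}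
    (hf : Free v f) : Free v (g.op.mulVec f) := by
  cases g with
  | J α i =>
    refine Free.onQubit_mulVec ?_ hf
    rintro rfl; exact hv (by simp [MGate.qubits])
  | star k T hk =>
    intro x b
    simp only [MGate.qubits, mem_insert, not_or] at hv
    simp only [MGate.op, Matrix.mulVec_diagonal, hf x b, Function.update_of_ne (Ne.symm hv.1)]
    congr 1
    refine prod_congr rfl fun j hj => ?_
    rw [Function.update_of_ne]
    rintro rfl; exact hv.2 hj

lemma op_mulVec_mul {g : MGate V} {h : Bits V → ℂ} (hh : ∀ v ∈ g.qubits, Free v h)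
    (f : Bits V → ℂ) :
    g.op.mulVec (fun x => h x * f x) = fun x => h x * g.op.mulVec f x := by
  cases g with
  | J α i => exact onQubit_mulVec_mul (hh i (by simp [MGate.qubits])) f
  | star k T hk =>
    ext x
    simp only [MGate.op, Matrix.mulVec_diagonal]
    ring

lemma Free.unitary_mulVec {G : List (MGate V)} {v : V} (hv : ∀ g ∈ G, v ∉ g.qubits)
    {f : Bits V → ℂ} (hf : Free v f) : Free v ((MGate.unitary G).mulVec f) := by
  induction G generalizing f with
  | nil => simpa [MGate.unitary] using hf
  | cons g G ih =>
    rw [List.forall_mem_cons] at hv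
    rw [MGate.unitary_cons, ← Matrix.mulVec_mulVec]
    exact ih hv.2 (hf.op_mulVec hv.1)

lemma unitary_mulVec_mul {G : List (MGate V)} {h : Bits V → ℂ}
    (hh : ∀ g ∈ G, ∀ v ∈ g.qubits, Free v h) (f : Bits V → ℂ) :
    (MGate.unitary G).mulVec (fun x => h x * f x) =
      fun x => h x * (MGate.unitary G).mulVec f x := by
  induction G generalizing f with
  | nil => simp [MGate.unitary]
  | cons g G ih =>
    rw [List.forall_mem_cons] at hh
    rw [MGate.unitary_cons, ← Matrix.mulVec_mulVec, op_mulVec_mul hh.1, ih hh.2,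
      Matrix.mulVec_mulVec]

/-- The state `k` of the qubits of `N`, which are neither outputs nor acted on, drops out. The
columns of the initial isometry are product states, `F y` being the factors of column `y`. -/
lemma traceOut_untouched {κ : Type*} [Fintype κ] {O N : Finset V} (hON : Disjoint O N)
    {G : List (MGate V)} (hG : ∀ g ∈ G, Disjoint g.qubits N) {F : κ → V → Fin 2 → ℂ}
    {k : Fin 2 → ℂ} (hk : Normalized k) (hF : ∀ y, ∀ v ∈ N, F y v = k) (ρ : Matrix κ κ ℂ) :
    let B : Matrix (Bits V) κ ℂ := Matrix.of fun x y => ∏ v, F y v (x v)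
    let a : Matrix (Bits V) κ ℂ := Matrix.of fun x y => ∏ v ∈ Nᶜ, F y v (x v)
    traceOut O (MGate.unitary G * B * ρ * (MGate.unitary G * B).conjTranspose) =
      (2⁻¹ : ℂ) ^ #N • traceOut O (MGate.unitary G * a * ρ *
        (MGate.unitary G * a).conjTranspose) := by
  intro B a
  let π : Bits V → ℂ := fun x => ∏ v ∈ N, k (x v)
  have hB : MGate.unitary G * B = Matrix.diagonal π * (MGate.unitary G * a) := by
    ext x y
    rw [Matrix.diagonal_mul]
    have h1 : (fun x => B x y) = fun x => π x * a x y := by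
      ext x
      simp only [B, a, π, Matrix.of_apply]
      rw [← prod_mul_prod_compl N]
      congr 1
      exact prod_congr rfl fun v hv => by rw [hF y v hv]
    have h2 := unitary_mulVec_mul (G := G) (h := π) (fun g hg v hv => Free.prod fun u hu =>
      free_coord (by rintro rfl; exact disjoint_left.1 (hG g hg) hv hu) _) fun x => a x y
    rw [← h1] at h2
    exact congrFun h2 x
  set X := MGate.unitary G * a * ρ * (MGate.unitary G * a).conjTranspose with hX
  have hUa : ∀ v ∈ N, ∀ x b y, (MGate.unitary G * a) (Function.update x v b) y =
      (MGate.unitary G * a) x y := by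
    intro v hv x b y
    refine Free.unitary_mulVec (f := fun x => a x y)
      (fun g hg h => disjoint_left.1 (hG g hg) h hv) ?_ x b
    exact Free.prod fun u hu => free_coord (by rintro rfl; exact (mem_compl.1 hu) hv) _
  have hXfree : ∀ v ∈ N, ∀ p p' b, X (Function.update p v b) (Function.update p' v b) = X p p' := by
    intro v hv p p' b
    rw [hX, Matrix.mul_apply, Matrix.mul_apply]
    refine sum_congr rfl fun q _ => ?_
    rw [Matrix.mul_apply, Matrix.mul_apply, Matrix.conjTranspose_apply, Matrix.conjTranspose_apply,
      hUa v hv]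
    simp only [hUa v hv]
  have hX' : MGate.unitary G * B * ρ * (MGate.unitary G * B).conjTranspose =
      Matrix.diagonal π * X * Matrix.diagonal (star π) := by
    rw [hB, Matrix.conjTranspose_mul, Matrix.diagonal_conjTranspose]
    simp only [hX, Matrix.mul_assoc]
  have hNO : ∀ v ∈ N, v ∉ O := fun v hv h => disjoint_left.1 hON h hv
  rw [hX']
  ext x x'
  simp only [traceOut, Matrix.of_apply, Matrix.mul_diagonal, Matrix.diagonal_mul,
    Matrix.smul_apply, smul_eq_mul, Pi.star_apply]
  have h1 : ∀ (x : Bits O) z, π (glue O x z) =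
      ∏ v ∈ N.subtype fun v => v ∉ O, k (z v) := by
    intro x z
    simp only [π]
    rw [← prod_subtype_of_mem _ hNO]
    exact prod_congr rfl fun v _ => by rw [glue_of_notMem x z v.2]
  have h2 := sum_mul_prod_of_free (N.subtype fun v => v ∉ O)
    (F := fun z => X (glue O x z) (glue O x' z)) (fun v hv z b => by
      change X (glue O x (Function.update z ⟨v, v.2⟩ b))
        (glue O x' (Function.update z ⟨v, v.2⟩ b)) = _
      rw [← update_glue x z v.2, ← update_glue x' z v.2]
      exact hXfree v (mem_subtype.1 hv) _ _ b) fun _ b => k b * star (k b)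
  have hk' : ∑ b, k b * star (k b) = 1 := hk
  rw [hk', prod_const, card_subtype, filter_true_of_mem hNO, one_div] at h2
  rw [← h2]
  refine sum_congr rfl fun z _ => ?_
  rw [h1, h1, star_prod, prod_mul_distrib]
  ring

/-- The columns of the initial isometry are product states. -/
lemma prep_eq_prod (k : Fin 2 → ℂ) (I : Finset V) :
    prep k I = Matrix.of fun x y => ∏ v,
      (fun b => if h : v ∈ I then if b = y ⟨v, h⟩ then 1 else 0 else k b : Fin 2 → ℂ) (x v) := by
  ext x y
  simp only [prep, Matrix.of_apply]
  rw [← prod_mul_prod_compl I]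
  have h1 : ∏ v ∈ I, (if h : v ∈ I then if x v = y ⟨v, h⟩ then 1 else 0 else k (x v)) =
      if (fun i : I => x i) = y then 1 else 0 := by
    rw [← prod_coe_sort]
    simp only [coe_mem, dite_true, prod_boole, mem_univ, true_implies, funext_iff]
  have h2 : ∏ v ∈ Iᶜ, (if h : v ∈ I then if x v = y ⟨v, h⟩ then 1 else 0 else k (x v)) =
      ∏ v ∈ Iᶜ, k (x v) :=
    prod_congr rfl fun v hv => by rw [dif_neg (mem_compl.1 hv)]
  rw [h1, h2, ite_mul, one_mul, zero_mul]

lemma normalized_zero : Normalized ![1, 0] := by simp [Normalized]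

lemma sum_hadamard_mul_plus (a : Fin 2) : ∑ b, hadamard a b * ketPM 0 0 b = ![1, 0] a := by
  have h := inv_sqrt_two_mul_self
  fin_cases a <;> simp [hadamard]
  linear_combination 2 * h

/-- Preparing the qubits of `Q` in `|0⟩` by Hadamard gates suffices if the other non-input qubits
are neither outputs nor acted on. -/
lemma traceOut_prep_plus {I O Q : Finset V} (hIQ : Disjoint I Q) (hO : O ⊆ I ∪ Q)
    {G : List (MGate V)} (hG : ∀ g ∈ G, g.qubits ⊆ I ∪ Q) (ρ : Op I) :
    traceOut O (MGate.unitary (Q.toList.map (MGate.J 0) ++ G) * prep (ketPM 0 0) I * ρ *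
      (MGate.unitary (Q.toList.map (MGate.J 0) ++ G) * prep (ketPM 0 0) I).conjTranspose) =
    traceOut O (MGate.unitary G * prep ![1, 0] I * ρ *
      (MGate.unitary G * prep ![1, 0] I).conjTranspose) := by
  let F₁ : Bits I → V → Fin 2 → ℂ := fun y v b =>
    if h : v ∈ I then if b = y ⟨v, h⟩ then 1 else 0 else
      if v ∈ Q then ![1, 0] b else ketPM 0 0 b
  let F₂ : Bits I → V → Fin 2 → ℂ := fun y v b =>
    if h : v ∈ I then if b = y ⟨v, h⟩ then 1 else 0 else ![1, 0] b
  have h1 : MGate.unitary (Q.toList.map (MGate.J 0)) * prep (ketPM 0 0) I =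
      Matrix.of fun x y => ∏ v, F₁ y v (x v) := by
    rw [unitary_map_J Q.nodup_toList, prep_eq_prod]
    ext x y
    simp only [F₁, Matrix.mul_apply, tensorOp_apply, Matrix.of_apply, ← prod_mul_distrib,
      mem_toList]
    rw [sum_prod_bits fun v b => (if v ∈ Q then hadamard else 1) (x v) b *
      if h : v ∈ I then if b = y ⟨v, h⟩ then 1 else 0 else ketPM 0 0 b]
    refine prod_congr rfl fun v _ => ?_
    by_cases hQ : v ∈ Q
    · have hI : v ∉ I := fun h => disjoint_left.1 hIQ h hQ
      simp only [hQ, hI, if_true, dite_false, sum_hadamard_mul_plus]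
    · simp [hQ, Matrix.one_apply]
  have hON : Disjoint O (I ∪ Q)ᶜ := disjoint_compl_right.mono_left hO
  have hGN : ∀ g ∈ G, Disjoint g.qubits (I ∪ Q)ᶜ := fun g hg =>
    disjoint_compl_right.mono_left (hG g hg)
  have h2 : prep ![1, 0] I = Matrix.of fun x y => ∏ v, F₂ y v (x v) := prep_eq_prod _ _
  have h3 : ∀ (x : Bits V) (y : Bits I), ∏ v ∈ (I ∪ Q)ᶜᶜ, F₁ y v (x v) =
      ∏ v ∈ (I ∪ Q)ᶜᶜ, F₂ y v (x v) := by
    refine fun x y => prod_congr rfl fun v hv => ?_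
    rw [compl_compl, mem_union] at hv
    by_cases hI : v ∈ I
    · simp [F₁, F₂, hI]
    · simp [F₁, F₂, hI, hv.resolve_left hI]
  rw [MGate.unitary_append, Matrix.mul_assoc (MGate.unitary G), h1, h2,
    traceOut_untouched (F := F₁) hON hGN (normalized_ketPM 0 0) (fun y v hv => ?_),
    traceOut_untouched (F := F₂) hON hGN normalized_zero (fun y v hv => ?_)]
  · simp only [h3]
  · simp only [mem_compl, mem_union, not_or] at hv
    ext b
    simp [F₂, hv.1]
  · simp only [mem_compl, mem_union, not_or] at hv
    ext b
    simp [F₁, hv.1, hv.2]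

end Untouched

/-! ### Simulation of circuits -/

section Circuits

variable {V : Type u} [Fintype V] [DecidableEq V]

/-- A circuit gate as a sequence of at most three layers of gates on disjoint sets of qubits. -/
def Gate.layers : Gate V → List (List (MGate V))
  | H i => [[MGate.J 0 i]]
  | Rz α i => [[MGate.J (-α) i], [MGate.J 0 i]]
  | CZ i j hij => [[MGate.star i {j} (by simpa using hij)]]
  | fanOut k T hk => [T.toList.map (MGate.J 0), [MGate.star k T hk], T.toList.map (MGate.J 0)]

lemma unitary_layers (g : Gate V) : MGate.unitary g.layers.flatten = g.op := by
  cases g with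
  | H i =>
    simp [Gate.layers, MGate.unitary, MGate.op, Gate.op, hadamard_mul_rz_zero,
      -neg_zero]
  | Rz α i =>
    simp only [Gate.layers, List.flatten_cons, List.flatten_nil, List.append_nil, Gate.op,
      MGate.unitary_append]
    simp only [MGate.unitary, List.foldl_cons, List.foldl_nil, mul_one, MGate.op,
      hadamard_mul_rz_zero, neg_neg, onQubit_eq_tensorOp, tensorOp_mul]
    congr 1
    ext1 v
    by_cases h : v = i
    · subst h; simp [← Matrix.mul_assoc, hadamard_mul_self]
    · simp [h]
  | CZ i j hij =>
    simp [Gate.layers, MGate.unitary, MGate.op, Gate.op, czOp, sg]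
  | fanOut k T hk =>
    simp only [Gate.layers, List.flatten_cons, List.flatten_nil, List.append_nil, Gate.op,
      MGate.unitary_append, unitary_map_J T.nodup_toList, mem_toList]
    rw [← tensorOp_star_tensorOp hk]
    simp [MGate.unitary]

omit [Fintype V] [DecidableEq V] in
lemma length_layers (g : Gate V) : g.layers.length ≤ 3 := by
  cases g <;> simp [Gate.layers]

omit [Fintype V] in
lemma qubits_layers (g : Gate V) : ∀ l ∈ g.layers, ∀ p ∈ l, p.qubits ⊆ g.qubits := by
  cases g with
  | H i => simp [Gate.layers, MGate.qubits, Gate.qubits]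
  | Rz α i => simp [Gate.layers, MGate.qubits, Gate.qubits]
  | CZ i j hij => simp [Gate.layers, MGate.qubits, Gate.qubits]
  | fanOut k T hk =>
    simp only [Gate.layers, List.forall_mem_cons, List.forall_mem_map, Gate.qubits]
    refine ⟨?_, ⟨?_, by simp⟩, ?_, by simp⟩
    · exact fun v hv => singleton_subset_iff.2 (mem_insert_of_mem (mem_toList.1 hv))
    · exact Subset.rfl
    · exact fun v hv => singleton_subset_iff.2 (mem_insert_of_mem (mem_toList.1 hv))

omit [Fintype V] in
lemma pairwise_map_J {L : List V} (hL : L.Nodup) :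
    (L.map (MGate.J 0)).Pairwise fun p r => Disjoint p.qubits r.qubits := by
  rw [List.pairwise_map]
  exact hL.imp fun h => by simpa [MGate.qubits] using h

omit [Fintype V] in
lemma pairwise_layers (g : Gate V) :
    ∀ l ∈ g.layers, l.Pairwise fun p r => Disjoint p.qubits r.qubits := by
  cases g with
  | H i => simp [Gate.layers]
  | Rz α i => simp [Gate.layers]
  | CZ i j hij => simp [Gate.layers]
  | fanOut k T hk =>
    simp only [Gate.layers, List.forall_mem_cons]
    exact ⟨pairwise_map_J T.nodup_toList, by simp, pairwise_map_J T.nodup_toList, by simp⟩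

omit [Fintype V] in
lemma sum_qubits_map_J (L : List V) :
    ((L.map (MGate.J 0)).map fun p => #p.qubits).sum = L.length := by
  simp [MGate.qubits, Function.comp_def]

omit [Fintype V] in
lemma size_layers (g : Gate V) :
    (g.layers.flatten.map fun p => #p.qubits).sum ≤ 3 * #g.qubits := by
  cases g with
  | H i => simp [Gate.layers, MGate.qubits, Gate.qubits]
  | Rz α i => simp [Gate.layers, MGate.qubits, Gate.qubits]
  | CZ i j hij => simp [Gate.layers, MGate.qubits, Gate.qubits]
  | fanOut k T hk =>
    simp only [Gate.layers, List.flatten_cons, List.flatten_nil, List.append_nil, List.map_append,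
      List.sum_append, sum_qubits_map_J, length_toList, Gate.qubits]
    simp only [MGate.qubits, List.map_cons, List.map_nil, List.sum_cons, List.sum_nil,
      card_insert_of_notMem hk]
    omega

/-- The sequence of gates of a circuit, each replaced by its layers. -/
def Circuit.compile (G : List (Gate V)) : List (MGate V) := G.flatMap fun g => g.layers.flatten

lemma unitary_compile (C : Circuit V) : MGate.unitary (Circuit.compile C.G) = C.unitary := by
  rw [Circuit.unitary]
  induction C.G with
  | nil => rfl
  | cons g G ih =>
    rw [Circuit.compile, List.flatMap_cons, MGate.unitary_append, unitary_layers, List.foldl_cons,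
      foldl_mul_eq, mul_one, ← ih, Circuit.compile]

omit [Fintype V] in
lemma size_compile (G : List (Gate V)) :
    ((Circuit.compile G).map fun p => #p.qubits).sum ≤ 3 * (G.map fun g => #g.qubits).sum := by
  induction G with
  | nil => simp [Circuit.compile]
  | cons g G ih =>
    rw [Circuit.compile] at ih ⊢
    have := size_layers g
    simp only [List.flatMap_cons, List.map_append, List.sum_append, List.map_cons, List.sum_cons]
    omega

omit [Fintype V] in
/-- The layers of the gates take three times as long as the gates. The additional unit of time is
for an initial layer of Hadamard gates. -/
lemma busy_compile (G : List (Gate V)) {d e : V → ℕ} (h : ∀ v, e v ≤ 3 * d v + 1) (v : V) :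
    busy MGate.qubits MGate.qubits e (Circuit.compile G) v ≤
      3 * busy Gate.qubits Gate.qubits d G v + 1 := by
  induction G generalizing d e with
  | nil => exact h v
  | cons g G ih =>
    rw [Circuit.compile, List.flatMap_cons, busy_append, busy_cons]
    refine ih fun u => ?_
    split_ifs with hu
    · refine (busy_layers (B := 3 * g.qubits.sup d + 1) (pairwise_layers g) (qubits_layers g)
        (fun w hw => (h w).trans ?_) hu).trans ?_
      · have := le_sup (f := d) hw
        omega
      · have := length_layers g
        omega
    · rw [busy_of_notMem]
      · exact h u
      · intro p hp hup
        obtain ⟨l, hl, hp⟩ := List.mem_flatten.1 hp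
        exact hu (qubits_layers g l hl p hp hup)

omit [Fintype V] in
lemma qubits_nonempty_gate (g : Gate V) : g.qubits.Nonempty := by
  cases g <;> simp [Gate.qubits]

/-- Every sequence of gates is realised by a runnable sequence of commands on a large enough
register. -/
lemma exists_commands (G : List (MGate V)) :
    ∃ (W : Type u) (_ : Fintype W) (_ : DecidableEq W) (w w' : V ↪ W) (A : List (Command W)),
      Command.Runnable ∅ A ∧ (∀ v, w' v ∉ measuredSet A) ∧
      (A.map fun p => #p.qubits).sum ≤ 9 * (G.map fun g => #g.qubits).sum ∧
      (∀ M, (∀ v, busy MGate.qubits MGate.qubits 0 G v ≤ M) →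
        ∀ u, busy Command.qubits Command.dom 0 A u ≤ 7 * M) ∧
      ∀ s : W → Fin 2, ∃ χ : W → Fin 2 → ℂ, (∀ u, Normalized (χ u)) ∧ ∀ ψ : Bits V → ℂ,
        run s A (regState w (fun _ => ketPM 0 0) ψ) =
          ((Real.sqrt 2 : ℂ)⁻¹ ^ numMeas A) • regState w' χ ((MGate.unitary G).mulVec ψ) := by
  obtain ⟨L, hL, hG⟩ : ∃ L : List (Fin G.length × MGate V),
      (L.map Prod.fst).Nodup ∧ L.map Prod.snd = G := by
    refine ⟨(List.finRange G.length).map fun i => (i, G.get i), ?_, ?_⟩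
    · simpa only [List.map_map, Function.comp_def, List.map_id'] using List.nodup_finRange _
    · simp only [List.map_map, Function.comp_def]
      exact List.map_get_finRange G
  let w : V ↪ V × Option (Fin G.length) × Bool :=
    ⟨fun v => (v, none, false), fun v v' h => congrArg Prod.fst h⟩
  obtain ⟨w', A, i1, -, i3, i4, i5, i6, i7⟩ := exists_compile L hL w.injective (by simp [w])
  have h1 : (L.map fun g => #g.2.qubits).sum = (G.map fun g => #g.qubits).sum := by
    have := congrArg (fun l => (l.map fun g : MGate V => #g.qubits).sum) hG
    simpa only [List.map_map, Function.comp_def] using this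
  rw [hG] at i6 i7
  exact ⟨_, inferInstance, inferInstance, w, ⟨w', i1⟩, A, i3 ∅ (by simp) (by simp), i4, h1 ▸ i5,
    fun M hM => i6 0 0 M (by simp) (by simp) (by simp) hM,
    fun s => i7 s (fun _ => ketPM 0 0) (fun _ _ _ _ => rfl) fun _ => normalized_ketPM 0 0⟩

lemma simulates_congr {I O : Finset V} {A A' : List (Command V)}
    (h : (⟨I, O, A'⟩ : Pattern V).channel = (⟨I, O, A⟩ : Pattern V).channel) {ι κ : Type*}
    {Φ : Op ι → Op κ} (hA : (⟨I, O, A⟩ : Pattern V).Simulates Φ) :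
    (⟨I, O, A'⟩ : Pattern V).Simulates Φ := by
  obtain ⟨eI, eO, h'⟩ := hA
  exact ⟨eI, eO, fun ρ => (congrFun h _).trans (h' ρ)⟩

/-- Every circuit is simulated by a pattern of proportional depth and size. -/
theorem exists_pattern (C : Circuit V)
    (hC : ∀ v ∈ C.O, v ∉ C.I → ∃ g ∈ C.G, v ∈ g.qubits) :
    ∃ (W : Type u) (_ : Fintype W) (_ : DecidableEq W) (t : Pattern W),
      t.WellFormed ∧ t.Simulates C.channel ∧ t.depth ≤ 29 * C.depth ∧ t.size ≤ 72 * C.size := by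
  -- the qubits to be initialised in `|0⟩` by a Hadamard gate
  let Q : Finset V := (univ.filter fun v => ∃ g ∈ C.G, v ∈ g.qubits) \ C.I
  let G : List (MGate V) := Q.toList.map (MGate.J 0) ++ Circuit.compile C.G
  obtain ⟨W, _, _, w, w', A, hrun, i4, i5, i6, i7⟩ := exists_commands G
  obtain ⟨A', a1, a2, a3, a4⟩ := exists_wellFormed (C.I.map w) (C.O.map w') hrun (by
    rw [disjoint_left]
    intro u hu
    obtain ⟨v, -, rfl⟩ := mem_map.1 hu
    exact i4 v)
  have hQ : #Q ≤ C.size := (card_le_card sdiff_subset).trans (card_touched_le _ _)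
  have hsize : (A'.map fun p => #p.qubits).sum ≤ 72 * C.size := by
    have h2 : (G.map fun g => #g.qubits).sum ≤ 4 * C.size := by
      have := size_compile C.G
      have h3 := sum_qubits_map_J Q.toList
      rw [length_toList] at h3
      simp only [G, List.map_append, List.sum_append, h3]
      rw [Circuit.size] at hQ ⊢
      omega
    omega
  refine ⟨W, inferInstance, inferInstance,
    ⟨C.I.map w, C.O.map w', A'⟩, a1, ?_, ?_, hsize⟩
  · refine simulates_congr a2 ?_
    have h := simulates_of_run (I := C.I) (O := C.O) (w := w) (w' := w')
      (U := MGate.unitary G) hrun i7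
    convert h using 1
    funext ρ
    simp only [Circuit.channel, ← unitary_compile]
    symm
    refine traceOut_prep_plus (I := C.I) (Q := Q) disjoint_sdiff (fun v hv => ?_)
      (fun p hp v hv => ?_) ρ
    · by_cases hI : v ∈ C.I
      · exact mem_union_left _ hI
      · exact mem_union_right _ (mem_sdiff.2 ⟨by simpa using hC v hv hI, hI⟩)
    · by_cases hI : v ∈ C.I
      · exact mem_union_left _ hI
      · obtain ⟨g, hg, hp⟩ := List.mem_flatMap.1 hp
        obtain ⟨l, hl, hp⟩ := List.mem_flatten.1 hp
        exact mem_union_right _ (mem_sdiff.2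
          ⟨by simpa using ⟨g, hg, qubits_layers g l hl p hp hv⟩, hI⟩)
  · rcases hG : C.G with _ | ⟨g, G'⟩
    · have h0 : C.size = 0 := by simp [Circuit.size, hG]
      have hA' : A' = [] := by
        rcases A' with _ | ⟨p, A'⟩
        · rfl
        · have := card_pos.2 (qubits_nonempty p)
          simp only [List.map_cons, List.sum_cons] at hsize
          omega
      have : longestChain Command.Dependent A' ≤ 0 := by
        refine longestChain_le qubits_subset_dom qubits_nonempty fun u => ?_
        simp [hA']
      exact this.trans (Nat.zero_le _)
    · have hd : ∀ v, busy Gate.qubits Gate.qubits 0 C.G v ≤ C.depth :=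
        fun v => busy_le_longestChain C.G v
      have hpos : 1 ≤ C.depth := by
        obtain ⟨v, hv⟩ := qubits_nonempty_gate g
        refine le_trans ?_ (hd v)
        rw [hG, busy_cons]
        refine le_trans ?_ (le_busy (fun _ => Subset.rfl) _ _ v)
        simp [hv]
      have he : ∀ v, busy MGate.qubits MGate.qubits 0 G v ≤ 3 * C.depth + 1 := fun v => by
        simp only [G]
        rw [busy_append]
        refine (busy_compile C.G (d := 0) (fun u => ?_) v).trans
          (Nat.add_le_add_right (Nat.mul_le_mul_left 3 (hd v)) 1)
        exact busy_layer (B := 0) (pairwise_map_J Q.nodup_toList) (by simp) (by simp)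
      have hA := i6 (3 * C.depth + 1) he
      have : longestChain Command.Dependent A' ≤ 7 * (3 * C.depth + 1) + 1 :=
        longestChain_le qubits_subset_dom qubits_nonempty (a4 _ hA)
      refine le_trans this ?_
      omega

/-- The circuit all of whose qubits are both inputs and outputs applies its unitary. -/
lemma simulatesUnitary_of_simulates {W : Type*} [Fintype W] [DecidableEq W] {t : Pattern W}
    {G : List (Gate V)} (h : t.Simulates (⟨univ, univ, G⟩ : Circuit V).channel) :
    t.SimulatesUnitary (⟨univ, univ, G⟩ : Circuit V).unitary := by
  obtain ⟨eI, eO, h⟩ := h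
  let ε : V ≃ (univ : Finset V) := (Equiv.subtypeUnivEquiv fun v => mem_univ v).symm
  let τ : Bits (univ : Finset V) ≃ Bits V := ε.symm.arrowCongr (Equiv.refl _)
  refine ⟨ε.trans eI, ε.trans eO, fun ρ => ?_⟩
  have h1 := h (ρ.submatrix τ τ)
  rw [Matrix.submatrix_submatrix] at h1
  refine h1.trans ?_
  set U := (⟨univ, univ, G⟩ : Circuit V).unitary with hU
  have hprep : prep ![1, 0] (univ : Finset V) = (1 : Op V).submatrix id τ := by
    ext x y
    rw [prep, Matrix.of_apply, Matrix.submatrix_apply, Matrix.one_apply, compl_univ, prod_empty]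
    congr 1
    rw [eq_iff_iff]
    constructor
    · rintro rfl; rfl
    · rintro rfl; rfl
  have hX : U * prep ![1, 0] (univ : Finset V) * ρ.submatrix τ τ *
      (U * prep ![1, 0] (univ : Finset V)).conjTranspose =
      U * ρ * U.conjTranspose := by
    have h2 : U * prep ![1, 0] (univ : Finset V) = U.submatrix id τ := by
      rw [hprep]
      have := Matrix.submatrix_mul_equiv U (1 : Op V) id (Equiv.refl _) τ
      simpa using this
    rw [h2, Matrix.conjTranspose_submatrix, Matrix.submatrix_mul_equiv, Matrix.submatrix_mul_equiv,
      Matrix.submatrix_id_id]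
  have h3 : (⟨univ, univ, G⟩ : Circuit V).channel (ρ.submatrix τ τ) =
      traceOut univ (U * ρ * U.conjTranspose) := by
    rw [← hX]; rfl
  have : IsEmpty {v : V // v ∉ (univ : Finset V)} := ⟨fun v => v.2 (mem_univ _)⟩
  rw [h3]
  ext x y
  simp only [Matrix.submatrix_apply, traceOut, Matrix.of_apply, univ_unique, sum_singleton]
  have h4 : ∀ (x : Bits (univ : Finset V)) z, glue univ x z = τ x := fun x z => by
    ext v; rw [glue_of_mem _ _ (mem_univ v)]; rfl
  rw [h4, h4]
  rfl

/-- A unitary that is the product of a sequence of gates is simulated by a pattern. -/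
lemma exists_pattern_unitary (G : List (Gate V)) {U : Op V}
    (hU : MGate.unitary (Circuit.compile G) = U) {D S : ℕ}
    (hD : longestChain (fun g h : Gate V => ¬ Disjoint g.qubits h.qubits) G ≤ D)
    (hS : (G.map fun g => #g.qubits).sum ≤ S) :
    ∃ (W : Type u) (_ : Fintype W) (_ : DecidableEq W) (t : Pattern W),
      t.WellFormed ∧ t.SimulatesUnitary U ∧ t.depth ≤ 29 * D ∧ t.size ≤ 72 * S := by
  obtain ⟨W, _, _, t, h1, h2, h3, h4⟩ := exists_pattern (⟨univ, univ, G⟩ : Circuit V)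
    fun v _ hv => absurd (mem_univ v) hv
  refine ⟨W, inferInstance, inferInstance, t, h1, ?_, h3.trans (Nat.mul_le_mul_left _ hD),
    h4.trans (Nat.mul_le_mul_left _ hS)⟩
  rw [← hU, unitary_compile ⟨univ, univ, G⟩]
  exact simulatesUnitary_of_simulates h2

end Circuits

/-! ### Parity and fan-out gates -/

section Parity

variable {V : Type u} [Fintype V] [DecidableEq V]

lemma longestChain_flatten_le (Ls : List (List (Gate V)))
    (hLs : ∀ l ∈ Ls, l.Pairwise fun g h => Disjoint g.qubits h.qubits) :
    longestChain (fun g h : Gate V => ¬ Disjoint g.qubits h.qubits) Ls.flatten ≤ Ls.length := by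
  refine longestChain_le (fun _ => Subset.rfl) qubits_nonempty_gate fun u => ?_
  refine (busy_layers (S := univ) (B := 0) hLs (fun _ _ _ _ => subset_univ _) (by simp)
    (mem_univ u)).trans (by omega)

lemma hadamardAll_mul_self : hadamardAll V * hadamardAll V = 1 := by
  rw [hadamardAll_eq, tensorOp_mul, hadamard_mul_self, tensorOp_one]

lemma exists_pattern_fanOutOp (k : V) (T : Finset V) (hk : k ∉ T) :
    ∃ (W : Type u) (_ : Fintype W) (_ : DecidableEq W) (t : Pattern W),
      t.WellFormed ∧ t.SimulatesUnitary (fanOutOp k T) ∧ t.depth ≤ 29 * 1 ∧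
        t.size ≤ 72 * (#T + 1) := by
  refine exists_pattern_unitary [Gate.fanOut k T hk] ?_ ?_ ?_
  · rw [Circuit.compile, List.flatMap_singleton, unitary_layers]
    rfl
  · exact longestChain_flatten_le [[Gate.fanOut k T hk]] (by simp)
  · simp [Gate.qubits, card_insert_of_notMem hk]

/-- The parity gate is a fan-out gate between two layers of Hadamard gates. -/
lemma exists_pattern_parityOp (k : V) (T : Finset V) (hk : k ∉ T) :
    ∃ (W : Type u) (_ : Fintype W) (_ : DecidableEq W) (t : Pattern W),
      t.WellFormed ∧ t.SimulatesUnitary (parityOp k T) ∧ t.depth ≤ 29 * 3 ∧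
        t.size ≤ 72 * (2 * Fintype.card V + #T + 1) := by
  let L : List (Gate V) := (univ : Finset V).toList.map Gate.H
  have hL : L.Pairwise fun g h => Disjoint g.qubits h.qubits := by
    rw [List.pairwise_map]
    exact (univ : Finset V).nodup_toList.imp fun h => by simpa [Gate.qubits] using h
  have hLU : MGate.unitary (Circuit.compile L) = hadamardAll V := by
    have : Circuit.compile L = (univ : Finset V).toList.map (MGate.J 0) := by
      rw [List.map_eq_flatMap]
      simp [Circuit.compile, L, List.flatMap_map, Gate.layers]
    rw [this, unitary_map_J (nodup_toList _), hadamardAll_eq]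
    simp
  have hLS : (L.map fun g => #g.qubits).sum = Fintype.card V := by
    simp [L, Gate.qubits, Function.comp_def]
  refine exists_pattern_unitary [L, [Gate.fanOut k T hk], L].flatten ?_ ?_ ?_
  · have : Circuit.compile [L, [Gate.fanOut k T hk], L].flatten = Circuit.compile L ++
        ((Gate.fanOut k T hk).layers.flatten ++ Circuit.compile L) := by
      simp [Circuit.compile]
    rw [this, MGate.unitary_append, MGate.unitary_append, unitary_layers, hLU, Gate.op,
      fanOutOp_eq_conj_parityOp hk]
    simp only [Matrix.mul_assoc, hadamardAll_mul_self, mul_one]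
    rw [← Matrix.mul_assoc, hadamardAll_mul_self, one_mul]
  · exact longestChain_flatten_le _ (by simp [hL])
  · simp only [List.flatten_cons, List.flatten_nil, List.append_nil, List.map_append,
      List.sum_append, hLS]
    simp only [List.map_cons, List.map_nil, List.sum_cons, List.sum_nil, Gate.qubits,
      card_insert_of_notMem hk]
    omega

end Parity

end OneWay

end

theorem mainTheorem3 :
    ∃ c : ℕ,
      -- every circuit with unbounded fan-out is simulated in depth `O(depth)` and size `O(size³)`
      (∀ (V : Type u) [Fintype V] [DecidableEq V] (C : OneWay.Circuit V),
        (∀ v ∈ C.O, v ∉ C.I → ∃ g ∈ C.G, v ∈ g.qubits) →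
        ∃ (W : Type u) (_ : Fintype W) (_ : DecidableEq W) (t : OneWay.Pattern W),
          t.WellFormed ∧ t.Simulates C.channel ∧
            t.depth ≤ c * C.depth ∧ t.size ≤ c * C.size ^ 3) ∧
      -- `H`, `R_z(α)` and `ΛZ` are simulated by patterns of constant size
      (∃ (W : Type) (_ : Fintype W) (_ : DecidableEq W) (t : OneWay.Pattern W),
        t.WellFormed ∧
          t.SimulatesUnitary (OneWay.onQubit OneWay.hadamard (0 : Fin 1)) ∧ t.size ≤ c) ∧
      (∀ α : ℝ, ∃ (W : Type) (_ : Fintype W) (_ : DecidableEq W) (t : OneWay.Pattern W),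
        t.WellFormed ∧
          t.SimulatesUnitary (OneWay.onQubit (OneWay.rz α) (0 : Fin 1)) ∧ t.size ≤ c) ∧
      (∃ (W : Type) (_ : Fintype W) (_ : DecidableEq W) (t : OneWay.Pattern W),
        t.WellFormed ∧
          t.SimulatesUnitary (OneWay.czOp (0 : Fin 2) 1) ∧ t.size ≤ c) ∧
      -- parity gates and fan-out gates on `n + 1` qubits, which are conjugate by Hadamard gates,
      -- are simulated in constant depth and size `O((n + 1)³)`
      (∀ n : ℕ,
        OneWay.fanOutOp (Fin.last n) (Finset.univ.erase (Fin.last n)) =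
          OneWay.hadamardAll (Fin (n + 1)) *
            OneWay.parityOp (Fin.last n) (Finset.univ.erase (Fin.last n)) *
              OneWay.hadamardAll (Fin (n + 1)) ∧
        (∃ (W : Type) (_ : Fintype W) (_ : DecidableEq W) (t : OneWay.Pattern W),
          t.WellFormed ∧
            t.SimulatesUnitary
              (OneWay.parityOp (Fin.last n) (Finset.univ.erase (Fin.last n))) ∧
            t.depth ≤ c ∧ t.size ≤ c * (n + 1) ^ 3) ∧
        (∃ (W : Type) (_ : Fintype W) (_ : DecidableEq W) (t : OneWay.Pattern W),
          t.WellFormed ∧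
            t.SimulatesUnitary
              (OneWay.fanOutOp (Fin.last n) (Finset.univ.erase (Fin.last n))) ∧
            t.depth ≤ c ∧ t.size ≤ c * (n + 1) ^ 3)) := by
  have hcube : ∀ n : ℕ, n ≤ n ^ 3 := fun n => Nat.le_self_pow (by norm_num) n
  have hgate : ∀ {m : ℕ} (g : OneWay.Gate (Fin m)), #g.qubits ≤ 2 →
      ∃ (W : Type) (_ : Fintype W) (_ : DecidableEq W) (t : OneWay.Pattern W),
        t.WellFormed ∧ t.SimulatesUnitary g.op ∧ t.size ≤ 216 := fun g hg => by
    obtain ⟨W, i, j, t, h1, h2, -, h3⟩ := OneWay.exists_pattern_unitary [g] (U := g.op) (by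
      rw [OneWay.Circuit.compile, List.flatMap_singleton, OneWay.unitary_layers]) le_rfl
      (S := 2) (by simpa using hg)
    exact ⟨W, i, j, t, h1, h2, h3.trans (by norm_num)⟩
  refine ⟨216, fun V _ _ C hC => ?_, hgate (OneWay.Gate.H 0) (by simp [OneWay.Gate.qubits]),
    fun α => hgate (OneWay.Gate.Rz α 0) (by simp [OneWay.Gate.qubits]),
    hgate (OneWay.Gate.CZ 0 1 (by decide)) card_le_two, fun n => ?_⟩
  · obtain ⟨W, i, j, t, h1, h2, h3, h4⟩ := OneWay.exists_pattern C hC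
    exact ⟨W, i, j, t, h1, h2, h3.trans (Nat.mul_le_mul_right _ (by norm_num)),
      h4.trans (Nat.mul_le_mul (by norm_num) (hcube _))⟩
  · have hk : Fin.last n ∉ Finset.univ.erase (Fin.last n) := Finset.notMem_erase _ _
    have hT : #(Finset.univ.erase (Fin.last n)) = n := by simp
    refine ⟨OneWay.fanOutOp_eq_conj_parityOp hk, ?_, ?_⟩
    · obtain ⟨W, i, j, t, h1, h2, h3, h4⟩ := OneWay.exists_pattern_parityOp _ _ hk
      refine ⟨W, i, j, t, h1, h2, h3.trans (by norm_num), h4.trans ?_⟩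
      rw [hT, Fintype.card_fin]
      have := hcube (n + 1)
      omega
    · obtain ⟨W, i, j, t, h1, h2, h3, h4⟩ := OneWay.exists_pattern_fanOutOp _ _ hk
      refine ⟨W, i, j, t, h1, h2, h3.trans (by norm_num), h4.trans ?_⟩
      rw [hT]
      have := hcube (n + 1)
      omega
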